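/- Let $\mathbb D$ be the open unit disk and $\mathbb F$ a field. A Blaschke product is a function on $\mathbb D$ of the form $B(z)=\lambda z^{m}\prod_{n}\frac{|\alpha_n|}{\alpha_n}\frac{\alpha_n-z}{1-\overline{\alpha_n}z}$ with $|\lambda|=1$, an integer $m\ge 0$, and a finite (possibly empty) or infinite sequence $(\alpha_n)$ in $\mathbb D\setminus\{0\}$ such that $\sum_n(1-|\alpha_n|)<\infty$. For $\theta\in(0,1)$ let $\Omega_{B,\theta}=\{z\in\mathbb D: |B(z)|<\theta\}$. Let $\rho(z,w)=\left|\frac{z-w}{1-\overline z w}\right|$ and $$\delta_{B,\eta}=\sup\{\rho(z,w): z,w \text{ lie in the same connected component of } \Omega_{B,\eta}\}$$ (with $\sup\emptyset=0$). For $\eta\in(0,1)$, $B$ has $\eta$-strong Property $\mathfrak B$ if for every $\theta\in(0,1)$ the closure in $\mathbb{C}$ of each component of $\Omega_{B,\theta}$ is contained in $\mathbb D$, and $\delta_{B,\eta}<1$. For $t\in\mathbb R$ put $\Sigma_{B,t}=\{z\in\mathbb D: |B(z)|<\frac{e^t-1}{e^t+1}\}$ (empty for $t\le 0$), and let $\mathbb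 B$ be the persistence module $t\mapsto H_*(\Sigma_{B,t};\mathbb F)=\bigoplus_k H_k(\Sigma_{B,t};\mathbb F)$ (singular homology) with the maps $\pi_{s,t}$, $s\le t$, induced by inclusion; let $\mathbb B_0$ be its degree-zero part $t\mapsto H_0(\Sigma_{B,t};\mathbb F)$. Two persistence modules $\mathbb V,\mathbb W$ over $\mathbb R$ are $\Delta$-interleaved ($\Delta>0$) if there are morphisms $F:\mathbb V\to\mathbb W[\Delta]$, $G:\mathbb W\to\mathbb V[\Delta]$ (where $\mathbb V[\Delta]_t=\mathbb V_{t+\Delta}$) such that $G[\Delta]\circ F$ and $F[\Delta]\circ G$ are the structure maps $\mathbb V\to\mathbb V[2\Delta]$ and $\mathbb W\to\mathbb W[2\Delta]$; $d_{int}(\mathbb V,\mathbb W)\in[0,\infty]$ is the infimum of all $\Delta>0$ for which they are $\Delta$-interleaved. **Lemma.** Let $B$ and $\widetilde B$ be Blaschke products with $\eta$-strong Property $\mathfrak B$. Suppose that $$\delta_0=\min\{\delta_{B,\eta},\delta_{\widetilde B,\eta}\}<\frac1e \quad\text{and}\quad \delta=\delta_0^{\,1-1/\sqrt{-\ln\delta_0}}<1-2\eta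 ,$$ and let $\gamma=1+\frac{2}{\sqrt{-\ln\delta_0}}$ and $T_0=\ln\frac{1+(\delta+2\eta)}{1-(\delta+2\eta)}$ (if $\delta_0=0$, which happens only when $B$ or $\widetilde B$ is constant, read $\delta=0$ and $\gamma=1$). If $\|\widetilde B-B\|_\infty=\sup_{z\in\mathbb D}|\widetilde B(z)-B(z)|<\eta$, then $$d_{int}(\mathbb B,\widetilde{\mathbb B})\le\max\{T_0,\,2\ln\gamma\}\quad\text{and}\quad d_{int}(\mathbb B_0,\widetilde{\mathbb B}_0)\le\max\{T_0,\,2\ln\gamma\}.$$ -/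

import Mathlib

open CategoryTheory Limits

universe u

/-! ### Blaschke products, level sets and their components -/

/-- The open unit disk. -/
def unitDiskC : Set ℂ := Metric.ball (0 : ℂ) 1

/-- The elementary Blaschke factor with zero `a`. -/
noncomputable def blaschkeFactor (a z : ℂ) : ℂ :=
  ((‖a‖ : ℂ) / a) * ((a - z) / (1 - (starRingEnd ℂ) a * z))

/-- `B` agrees on the unit disk with a (finite or infinite) Blaschke product
`c * z ^ m * ∏ₙ blaschkeFactor (αₙ) z`, where `|c| = 1`, the `αₙ` (repeated according to
multiplicity) lie in the punctured disk and satisfy the Blaschke condition.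
Values of `B` outside the unit disk are irrelevant. -/
def IsBlaschkeProduct (B : ℂ → ℂ) : Prop :=
  ∃ (c : ℂ) (m : ℕ) (ι : Type) (_ : Countable ι) (α : ι → ℂ),
    ‖c‖ = 1 ∧ (∀ n, α n ≠ 0 ∧ α n ∈ unitDiskC) ∧ Summable (fun n => 1 - ‖α n‖) ∧
      ∀ z ∈ unitDiskC, ∃ P : ℂ, HasProd (fun n => blaschkeFactor (α n) z) P ∧
        B z = c * z ^ m * P

/-- The level set `Ω_{u,θ} = {z ∈ 𝔻 : |u z| < θ}`. -/
def levelSet (u : ℂ → ℂ) (θ : ℝ) : Set ℂ := {z | z ∈ unitDiskC ∧ ‖u z‖ < θ}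

/-- The pseudo-hyperbolic distance on the unit disk. -/
noncomputable def pseudoHypDist (z w : ℂ) : ℝ := ‖(z - w) / (1 - (starRingEnd ℂ) z * w)‖

/-- Property 𝔅: for every `θ ∈ (0,1)` the closure of each connected component of `Ω_{u,θ}` is
contained in the open unit disk. -/
def HasPropertyB (u : ℂ → ℂ) : Prop :=
  ∀ θ : ℝ, 0 < θ → θ < 1 → ∀ z ∈ levelSet u θ,
    closure (connectedComponentIn (levelSet u θ) z) ⊆ unitDiskC

/-- `δ_{u,η}`: the supremum of the pseudo-hyperbolic distances of two points in the same component
of `Ω_{u,η}`. (The set is bounded by `1`; the supremum of the empty set is `0`.) -/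
noncomputable def componentDiam (u : ℂ → ℂ) (η : ℝ) : ℝ :=
  sSup {r : ℝ | ∃ z ∈ levelSet u η, ∃ w ∈ connectedComponentIn (levelSet u η) z,
    r = pseudoHypDist z w}

/-- `η`-strong Property 𝔅. -/
def HasStrongPropertyB (u : ℂ → ℂ) (η : ℝ) : Prop :=
  0 < η ∧ η < 1 ∧ HasPropertyB u ∧ componentDiam u η < 1

/-- The supremum norm over the unit disk. -/
noncomputable def diskSupNorm (f : ℂ → ℂ) : ENNReal := ⨆ z ∈ unitDiskC, ENNReal.ofReal ‖f z‖

/-! ### Persistence modules and the interleaving distance -/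

/-- A persistence module over the field `𝔽`, indexed by the real line: vector spaces `V_t` with
functorial maps `π_{s,t} : V_s → V_t` for `s ≤ t`, vanishing for all sufficiently negative
parameters. -/
structure PersistenceModule (𝔽 : Type u) [Field 𝔽] where
  /-- The underlying functor. -/
  toFunctor : ℝ ⥤ ModuleCat.{u} 𝔽
  /-- The spaces vanish far to the left. -/
  eventually_zero : ∃ s₀ : ℝ, ∀ s ≤ s₀, Subsingleton (toFunctor.obj s)

/-- Translation by `Δ` on the parameter line. -/
def shiftReal (Δ : ℝ) : ℝ ⥤ ℝ :=
  Monotone.functor (f := fun t : ℝ => t + Δ) (fun _ _ h => add_le_add_left h Δ)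

namespace PersistenceModule

variable {𝔽 : Type u} [Field 𝔽]

/-- The `Δ`-shift `V[Δ]`, with `V[Δ]_t = V_{t+Δ}`. -/
def shift (V : PersistenceModule 𝔽) (Δ : ℝ) : PersistenceModule 𝔽 where
  toFunctor := shiftReal Δ ⋙ V.toFunctor
  eventually_zero := by
    obtain ⟨s₀, h⟩ := V.eventually_zero
    exact ⟨s₀ - Δ, fun s hs => h (s + Δ) (by linarith)⟩

/-- Morphisms of persistence modules are the natural transformations. -/
abbrev Hom (V W : PersistenceModule 𝔽) := V.toFunctor ⟶ W.toFunctor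

/-- `V` and `W` are `Δ`-interleaved: there are morphisms `F : V → W[Δ]` and `G : W → V[Δ]` such
that `G[Δ] ∘ F` and `F[Δ] ∘ G` are the shift morphisms `V_t → V_{t+2Δ}` and `W_t → W_{t+2Δ}`. -/
def Interleaved (V W : PersistenceModule 𝔽) (Δ : ℝ) : Prop :=
  ∃ (hΔ : 0 < Δ) (F : Hom V (W.shift Δ)) (G : Hom W (V.shift Δ)),
    (∀ t : ℝ, F.app t ≫ G.app (t + Δ) =
      V.toFunctor.map (homOfLE (by linarith : t ≤ t + Δ + Δ))) ∧
    (∀ t : ℝ, G.app t ≫ F.app (t + Δ) =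
      W.toFunctor.map (homOfLE (by linarith : t ≤ t + Δ + Δ)))

/-- The interleaving distance (with value `∞` if there is no interleaving). -/
noncomputable def intDist (V W : PersistenceModule 𝔽) : ENNReal :=
  ⨅ (Δ : ℝ) (_ : V.Interleaved W Δ), ENNReal.ofReal Δ

end PersistenceModule

/-! ### The persistence modules induced by a function on the disk -/

/-- `θ(t) = (e^t - 1) / (e^t + 1)`, the inverse of `θ ↦ ln ((1 + θ) / (1 - θ))`. -/
noncomputable def thetaParam (t : ℝ) : ℝ := (Real.exp t - 1) / (Real.exp t + 1)

theorem thetaParam_mono : Monotone thetaParam := by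
  intro s t h
  have h1 := Real.exp_le_exp.mpr h
  have h2 := Real.exp_pos s
  unfold thetaParam
  rw [div_le_div_iff₀ (by linarith) (by linarith)]
  nlinarith

theorem thetaParam_nonpos {t : ℝ} (h : t ≤ 0) : thetaParam t ≤ 0 := by
  have h1 := Real.exp_le_one_iff.mpr h
  have h2 := Real.exp_pos t
  exact div_nonpos_of_nonpos_of_nonneg (by linarith) (by linarith)

/-- `Σ_{u,t} = Ω_{u,θ(t)}`; it is empty for `t ≤ 0`. -/
def sublevel (u : ℂ → ℂ) (t : ℝ) : Set ℂ := levelSet u (thetaParam t)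

theorem sublevel_mono (u : ℂ → ℂ) : Monotone (sublevel u) :=
  fun _ _ h _ hz => ⟨hz.1, hz.2.trans_le (thetaParam_mono h)⟩

theorem isEmpty_sublevel (u : ℂ → ℂ) {t : ℝ} (h : t ≤ 0) : IsEmpty (sublevel u t) :=
  ⟨fun z => absurd (z.2.2.trans_le (thetaParam_nonpos h)) (not_lt.mpr (norm_nonneg _))⟩

/-- The filtration `t ↦ Σ_{u,t}` of topological spaces, with the inclusions. -/
noncomputable def sublevelFunctor (u : ℂ → ℂ) : ℝ ⥤ TopCat.{0} where
  obj t := TopCat.of (sublevel u t)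
  map f := TopCat.ofHom ⟨Set.inclusion (sublevel_mono u (leOfHom f)), by fun_prop⟩

/-- Singular homology `H_k(X; 𝔽)`. -/
noncomputable def homologyF (𝔽 : Type u) [Field 𝔽] (k : ℕ) : TopCat.{0} ⥤ ModuleCat.{u} 𝔽 :=
  ((AlgebraicTopology.singularHomologyFunctor (ModuleCat.{u} 𝔽) k).obj (ModuleCat.of 𝔽 𝔽))

theorem subsingleton_homologyF (𝔽 : Type u) [Field 𝔽] (k : ℕ) (X : TopCat.{0}) [IsEmpty X] :
    Subsingleton ((homologyF 𝔽 k).obj X) := by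
  rw [← ModuleCat.isZero_iff_subsingleton]
  by_cases hk : k = 0
  · subst hk
    refine IsZero.of_iso ?_
      (AlgebraicTopology.singularHomologyFunctorZeroOfTotallyDisconnectedSpace _ _ _)
    exact (IsZero.iff_id_eq_zero _).2 (Sigma.hom_ext _ _ fun x => isEmptyElim (α := X) x)
  · exact AlgebraicTopology.isZero_singularHomologyFunctor_of_totallyDisconnectedSpace _ _ _ _ hk

/-- Total singular homology `H_*(X; 𝔽) = ⨁ₖ H_k(X; 𝔽)`. -/
noncomputable def totalHomologyF (𝔽 : Type u) [Field 𝔽] : TopCat.{0} ⥤ ModuleCat.{u} 𝔽 where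
  obj X := ModuleCat.of 𝔽 (DirectSum ℕ fun k => (homologyF 𝔽 k).obj X)
  map f := ModuleCat.ofHom (DirectSum.lmap fun k => ((homologyF 𝔽 k).map f).hom)

/-- The persistence module `t ↦ H_k(Σ_{u,t}; 𝔽)`, with the maps induced by the inclusions. -/
noncomputable def levelPersistenceDeg (𝔽 : Type u) [Field 𝔽] (k : ℕ) (u : ℂ → ℂ) :
    PersistenceModule 𝔽 where
  toFunctor := sublevelFunctor u ⋙ homologyF 𝔽 k
  eventually_zero := ⟨0, fun s hs => by
    have : IsEmpty ((sublevelFunctor u).obj s) := isEmpty_sublevel u hs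
    exact subsingleton_homologyF 𝔽 k _⟩

/-- The persistence module `t ↦ ⨁ₖ H_k(Σ_{u,t}; 𝔽)`, with the maps induced by the inclusions. -/
noncomputable def levelPersistence (𝔽 : Type u) [Field 𝔽] (u : ℂ → ℂ) : PersistenceModule 𝔽 where
  toFunctor := sublevelFunctor u ⋙ totalHomologyF 𝔽
  eventually_zero := ⟨0, fun s hs => by
    have : IsEmpty ((sublevelFunctor u).obj s) := isEmpty_sublevel u hs
    have := fun k => subsingleton_homologyF 𝔽 k ((sublevelFunctor u).obj s)
    exact ⟨fun x y => DFinsupp.ext fun k => (this k).elim _ _⟩⟩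

/-!
The interleaving is given by inclusions of sublevel sets: with `Δ = max T₀ (2 log γ)`, each of
`Σ_{B,t}` and `Σ_{B̃,t}` is contained in the sublevel set of the other function at `t + Δ`, so that
any functor applied to the two filtrations, homology in particular, gives interleaved modules
(`interleaved_of_sublevel_subset`).

For the inclusions, let `K` be a component of `Ω_{B,η}`, where `B` is the function with the smaller
`δ_{·,η}`. Its closure is compact in the disk, and on its boundary `|B̃ - B| < η ≤ |B|`. By Rouché's
theorem (`HasZeros.card_eq_of_norm_lt`) `B` and `B̃` have the same number of zeros in `K`; as
`|B| < η` at each zero of `B` or `B̃`, all zeros are captured in this way. So the zeros can be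
paired, at pseudo-hyperbolic distance at most `δ₀` (`exists_equiv_zeros`).

Now `|B z|` is the product of the distances `ρ(z, a)` over its zeros `a`. If `ρ(z, b) ≥ δ` and
`ρ(a, b) ≤ δ₀`, then `ρ(z, b) ^ γ ≤ ρ(z, a)` (`pseudoHypDist_rpow_le`): by the strong triangle
inequality this amounts to `y ^ γ (1 - y δ₀) ≤ y - δ₀` for `δ ≤ y ≤ 1`, which follows from concavity
(`rpow_mul_one_sub_le_sub`). Multiplying over all pairs of zeros, `|B̃ z| ^ γ ≤ |B z|` wherever
`|B̃ z| ≥ δ`, and likewise with `B` and `B̃` exchanged. In the parameter `t` a power `γ` is a shift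
by at most `2 log γ` (`lt_thetaParam_add`), while points with `|B̃ z| < δ` lie below the level `T₀`.

Rouché's theorem on a disk comes from integrating logarithmic derivatives; on a bounded domain, the
number of zeros of `B + τ (B̃ - B)` is locally constant in `τ ∈ [0, 1]`, as is seen by applying the
theorem to small disks around the zeros.
-/

/-! ### Two real inequalities -/

/-- The case `y = δ` of `rpow_mul_one_sub_le_sub`, in the variable `s = √(-log δ₀)`. -/
theorem exp_mul_one_sub_exp_le {s : ℝ} (hs : 1 ≤ s) :
    Real.exp (-s ^ 2 - s + 2) * (1 - Real.exp (-s ^ 2 + s) * Real.exp (-s ^ 2)) ≤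
      Real.exp (-s ^ 2 + s) - Real.exp (-s ^ 2) := by
  obtain ⟨v, rfl⟩ : ∃ v, s = 1 + v := ⟨s - 1, by ring⟩
  have hv : 0 ≤ v := by linarith
  set q := Real.exp (-v) with hq
  set E := Real.exp (-2 * v ^ 2) with hE
  set c := Real.exp (-1) with hc
  set k := Real.exp (-(1 + v) ^ 2 + (1 + v)) with hk
  have hq0 : 0 < q := Real.exp_pos _
  have hc0 : 0 < c := Real.exp_pos _
  have hk0 : 0 < k := Real.exp_pos _
  have h1 : Real.exp (-(1 + v) ^ 2 - (1 + v) + 2) = k * q ^ 2 := by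
    rw [hk, hq, ← Real.exp_nat_mul, ← Real.exp_add]; congr 1; push_cast; ring
  have h2 : Real.exp (-(1 + v) ^ 2) = k * (c * q) := by
    rw [hk, hq, hc, ← Real.exp_add, ← Real.exp_add]; congr 1; ring
  have h3 : q ^ 2 * (k * (k * (c * q))) = c * q ^ 5 * E := by
    rw [hk, hq, hc, hE, ← Real.exp_nat_mul, ← Real.exp_nat_mul]
    simp only [← Real.exp_add]
    congr 1; push_cast; ring
  have hE1 : 1 - 2 * v ^ 2 ≤ E := by
    have := Real.add_one_le_exp (-2 * v ^ 2); rw [hE]; linarith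
  have hq1 : q * (1 + v) ≤ 1 := by
    have := Real.add_one_le_exp v
    have h : q * Real.exp v = 1 := by rw [hq, ← Real.exp_add]; simp
    nlinarith
  have hq2 : q ^ 2 * (1 + 2 * v) ≤ 1 := by
    have := Real.add_one_le_exp (2 * v)
    have h : q ^ 2 * Real.exp (2 * v) = 1 := by
      rw [hq, ← Real.exp_nat_mul, ← Real.exp_add]; simp
    nlinarith [sq_nonneg q]
  have hqle : q ≤ 1 := by nlinarith
  have hc2 : 2 * c ≤ 1 := by
    have := Real.add_one_le_exp (1 : ℝ)
    have h : c * Real.exp 1 = 1 := by rw [hc, ← Real.exp_add]; simp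
    nlinarith
  have key : c * q * (1 - q ^ 4 * E) ≤ 1 - q ^ 2 := by
    have e1 : 1 - q ^ 4 * E ≤ (1 - q ^ 2) * (1 + q ^ 2) + v * q ^ 2 * (2 * v * q ^ 2) := by
      nlinarith [pow_pos hq0 4]
    have e2 : v * q ^ 2 * (2 * v * q ^ 2) ≤ v * q ^ 2 * (1 - q ^ 2) :=
      mul_le_mul_of_nonneg_left (by linarith) (by positivity)
    have e3 : c * q * (1 + q ^ 2 * (1 + v)) ≤ 1 := by
      have : q * (1 + q ^ 2 * (1 + v)) ≤ 2 := by nlinarith [sq_nonneg q]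
      nlinarith
    have e4 : 0 ≤ 1 - q ^ 2 := by nlinarith
    calc c * q * (1 - q ^ 4 * E) ≤ c * q * ((1 + q ^ 2 * (1 + v)) * (1 - q ^ 2)) :=
          mul_le_mul_of_nonneg_left (by linarith) (by positivity)
      _ = c * q * (1 + q ^ 2 * (1 + v)) * (1 - q ^ 2) := by ring
      _ ≤ 1 * (1 - q ^ 2) := mul_le_mul_of_nonneg_right e3 e4
      _ = 1 - q ^ 2 := one_mul _
  rw [h1, h2]
  have : k * q ^ 2 * (1 - k * (k * (c * q))) = k * (q ^ 2 - c * q ^ 5 * E) := by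
    rw [← h3]; ring
  rw [this, ← mul_one_sub]
  exact mul_le_mul_of_nonneg_left (by nlinarith) hk0.le

/-- If `y` is a pseudo-hyperbolic distance to a point and `d` bounds the displacement of that point,
then the new distance is at least `(y - d) / (1 - y d)`; this inequality says that for `y ≥ δ` it is
at least `y ^ γ`. The difference of the two sides is concave in `y` and vanishes at `y = 1`, so that
only the endpoint `y = δ` has to be examined. -/
theorem rpow_mul_one_sub_le_sub {s y : ℝ} (hs : 1 ≤ s) (hy : Real.exp (-s ^ 2 + s) ≤ y)
    (hy1 : y ≤ 1) :
    y ^ (1 + 2 / s) * (1 - y * Real.exp (-s ^ 2)) ≤ y - Real.exp (-s ^ 2) := by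
  set d := Real.exp (-s ^ 2) with hd
  set D := Real.exp (-s ^ 2 + s) with hD
  set γ := 1 + 2 / s with hγ
  have hs0 : 0 < s := by linarith
  have hD0 : 0 < D := Real.exp_pos _
  have hd0 : 0 < d := Real.exp_pos _
  have hγ1 : 1 < γ := lt_add_of_pos_right 1 (by positivity)
  have hdγ : d * (γ + 1) ≤ γ - 1 := by
    have h1 := Real.add_one_le_exp (s ^ 2)
    have h2 : d * Real.exp (s ^ 2) = 1 := by rw [hd, ← Real.exp_add]; simp
    have h3 : d * (s + 1) ≤ 1 := by nlinarith
    have h4 : γ + 1 = 2 / s * (s + 1) := by rw [hγ]; field_simp; ring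
    have h5 : γ - 1 = 2 / s := by rw [hγ]; ring
    rw [h4, h5]
    have : 0 < 2 / s := by positivity
    nlinarith
  have hD1 : D ≤ 1 := hy.trans hy1
  let ψ : ℝ → ℝ := fun y => y - d - y ^ γ + d * y ^ (γ + 1)
  have hconc : ConcaveOn ℝ (Set.Icc D 1) ψ := by
    refine concaveOn_of_hasDerivWithinAt2_nonpos (convex_Icc _ _)
      (f' := fun y => 1 - γ * y ^ (γ - 1) + d * ((γ + 1) * y ^ γ))
      (f'' := fun y => - (γ * ((γ - 1) * y ^ (γ - 1 - 1))) + d * ((γ + 1) * (γ * y ^ (γ - 1))))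
      ?_ ?_ ?_ ?_
    · refine ContinuousOn.add (ContinuousOn.sub (by fun_prop) ?_) (continuousOn_const.mul ?_)
      · exact continuousOn_id.rpow_const fun x hx => Or.inr (by linarith)
      · exact continuousOn_id.rpow_const fun x hx => Or.inr (by linarith)
    · intro x hx
      rw [interior_Icc] at hx
      have hx0 : x ≠ 0 := (hD0.trans hx.1).ne'
      have h1 := Real.hasDerivAt_rpow_const (x := x) (p := γ) (Or.inl hx0)
      have h2 := Real.hasDerivAt_rpow_const (x := x) (p := γ + 1) (Or.inl hx0)
      rw [add_sub_cancel_right] at h2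
      exact ((((hasDerivAt_id x).sub_const d).sub h1).add (h2.const_mul d)).hasDerivWithinAt
    · intro x hx
      rw [interior_Icc] at hx
      have hx0 : x ≠ 0 := (hD0.trans hx.1).ne'
      have h1 := Real.hasDerivAt_rpow_const (x := x) (p := γ - 1) (Or.inl hx0)
      have h2 := Real.hasDerivAt_rpow_const (x := x) (p := γ) (Or.inl hx0)
      have h3 := ((h1.const_mul γ).const_sub 1).add ((h2.const_mul (γ + 1)).const_mul d)
      exact h3.hasDerivWithinAt
    · intro x hx
      rw [interior_Icc] at hx
      have hx0 : 0 < x := hD0.trans hx.1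
      have h1 : x ^ (γ - 1) = x ^ (γ - 1 - 1) * x := by
        rw [← Real.rpow_add_one hx0.ne']; congr 1; ring
      have h2 : 0 < x ^ (γ - 1 - 1) := Real.rpow_pos_of_pos hx0 _
      have h3 : d * (γ + 1) * x ≤ γ - 1 :=
        (mul_le_of_le_one_right (by positivity) hx.2.le).trans hdγ
      have h4 : -(γ * ((γ - 1) * x ^ (γ - 1 - 1))) + d * ((γ + 1) * (γ * x ^ (γ - 1))) =
          - (γ * x ^ (γ - 1 - 1) * (γ - 1 - d * (γ + 1) * x)) := by rw [h1]; ring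
      rw [h4]
      have : 0 ≤ γ * x ^ (γ - 1 - 1) := by positivity
      nlinarith [mul_nonneg this (sub_nonneg.2 h3)]
  have hψ1 : ψ 1 = 0 := by simp [ψ]
  have hpow : ∀ x : ℝ, 0 < x → ψ x = x - d - x ^ γ * (1 - x * d) := by
    intro x hx
    simp only [ψ, Real.rpow_add_one hx.ne']; ring
  have hψD : 0 ≤ ψ D := by
    have h1 := exp_mul_one_sub_exp_le hs
    have h2 : D ^ γ = Real.exp (-s ^ 2 - s + 2) := by
      rw [hD, ← Real.exp_mul, hγ]; congr 1; field_simp; ring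
    rw [hpow D hD0, h2]
    linarith
  have := hconc.min_le_of_mem_Icc ⟨le_rfl, hD1⟩ ⟨hD1, le_rfl⟩ ⟨hy, hy1⟩
  rw [hψ1, min_eq_right hψD, hpow y (hD0.trans_le hy)] at this
  linarith

/-- Passing from `y ^ γ` to `y` costs at most `2 log γ` in the parameter `t`, by Bernoulli's
inequality. -/
theorem lt_thetaParam_add {γ y t Δ : ℝ} (hγ : 1 ≤ γ) (hy : 0 ≤ y)
    (ht : y ^ γ < thetaParam t) (hΔ : 2 * Real.log γ ≤ Δ) : y < thetaParam (t + Δ) := by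
  have hγ0 : 0 < γ := by linarith
  have het := Real.exp_pos t
  have hE : γ ^ 2 * Real.exp t ≤ Real.exp (t + Δ) := by
    rw [Real.exp_add, mul_comm]
    refine mul_le_mul_of_nonneg_left ?_ het.le
    calc γ ^ 2 = Real.exp (2 * Real.log γ) := by
          rw [mul_comm, Real.exp_mul, Real.exp_log hγ0]; norm_num
      _ ≤ _ := Real.exp_le_exp.2 hΔ
  have hq0 : 0 ≤ y ^ γ := Real.rpow_nonneg hy _
  have hq1 : y ^ γ < 1 := by
    refine ht.trans ?_
    unfold thetaParam
    rw [div_lt_one (by linarith)]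
    linarith
  have hy1 : y < 1 := by
    by_contra! h
    exact absurd (Real.one_le_rpow h hγ0.le) (not_le.2 hq1)
  have hB : 1 + γ * (y - 1) ≤ y ^ γ := by
    have := one_add_mul_self_le_rpow_one_add (s := y - 1) (by linarith) hγ
    simpa using this
  set q := y ^ γ
  have h1 : 1 + q < Real.exp t * (1 - q) := by
    unfold thetaParam at ht
    rw [lt_div_iff₀ (by linarith)] at ht
    linarith
  have h2 : 1 + y ≤ γ * (1 + q) := by
    -- Bernoulli gives `γ y ≤ q + γ - 1`, and `q + γ - 1 ≤ γ (γ q + γ - 1)`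
    have : γ * (1 + y) ≤ γ * (γ * (1 + q)) := by
      nlinarith [mul_nonneg hq0 (sub_nonneg.2 hγ), mul_nonneg (sub_nonneg.2 hγ) (sub_nonneg.2 hγ)]
    exact le_of_mul_le_mul_left this hγ0
  have h3 : (1 + y) * (1 - q) ≤ γ ^ 2 * (1 + q) * (1 - y) := by
    calc (1 + y) * (1 - q) ≤ γ * (1 + q) * (γ * (1 - y)) :=
          mul_le_mul h2 (by linarith) (by linarith) (by positivity)
      _ = _ := by ring
  have h4 : (1 + y) * (1 - q) < Real.exp (t + Δ) * (1 - y) * (1 - q) := by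
    calc (1 + y) * (1 - q) ≤ γ ^ 2 * (1 + q) * (1 - y) := h3
      _ = γ ^ 2 * (1 - y) * (1 + q) := by ring
      _ < γ ^ 2 * (1 - y) * (Real.exp t * (1 - q)) :=
          mul_lt_mul_of_pos_left h1 (mul_pos (by positivity) (by linarith))
      _ = γ ^ 2 * Real.exp t * ((1 - y) * (1 - q)) := by ring
      _ ≤ Real.exp (t + Δ) * ((1 - y) * (1 - q)) :=
          mul_le_mul_of_nonneg_right hE (mul_nonneg (by linarith) (by linarith))
      _ = _ := by ring
  have h5 := lt_of_mul_lt_mul_right h4 (by linarith)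
  unfold thetaParam
  rw [lt_div_iff₀ (by linarith [Real.exp_pos (t + Δ)])]
  linarith

/-! ### The pseudo-hyperbolic distance -/

theorem mem_unitDiskC {z : ℂ} : z ∈ unitDiskC ↔ ‖z‖ < 1 := by simp [unitDiskC]

theorem one_sub_conj_mul_ne_zero {z w : ℂ} (hz : ‖z‖ < 1) (hw : ‖w‖ < 1) :
    1 - (starRingEnd ℂ) z * w ≠ 0 := by
  intro h
  have h1 : ‖(starRingEnd ℂ) z * w‖ = 1 := by rw [← sub_eq_zero.1 h]; simp
  rw [norm_mul, RCLike.norm_conj] at h1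
  nlinarith [norm_nonneg z, norm_nonneg w]

theorem norm_one_sub_conj_mul_comm (z w : ℂ) :
    ‖1 - (starRingEnd ℂ) z * w‖ = ‖1 - (starRingEnd ℂ) w * z‖ := by
  rw [← RCLike.norm_conj (1 - (starRingEnd ℂ) z * w)]
  congr 1
  simp [mul_comm]

theorem pseudoHypDist_comm (z w : ℂ) : pseudoHypDist z w = pseudoHypDist w z := by
  simp only [pseudoHypDist, norm_div, norm_sub_rev z w, norm_one_sub_conj_mul_comm z w]

theorem pseudoHypDist_nonneg (z w : ℂ) : 0 ≤ pseudoHypDist z w := norm_nonneg _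

/-- The identity behind `1 - ρ(z, w)² = (1 - |z|²) (1 - |w|²) / |1 - z̄ w|²`. -/
theorem norm_one_sub_conj_mul_sq (z w : ℂ) :
    ‖1 - (starRingEnd ℂ) z * w‖ ^ 2 = ‖z - w‖ ^ 2 + (1 - ‖z‖ ^ 2) * (1 - ‖w‖ ^ 2) := by
  simp only [← Complex.normSq_eq_norm_sq, Complex.normSq_apply]
  simp
  ring

theorem pseudoHypDist_lt_one {z w : ℂ} (hz : ‖z‖ < 1) (hw : ‖w‖ < 1) : pseudoHypDist z w < 1 := by
  have h0 := norm_pos_iff.2 (one_sub_conj_mul_ne_zero hz hw)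
  rw [pseudoHypDist, norm_div, div_lt_one h0]
  refine lt_of_pow_lt_pow_left₀ 2 h0.le ?_
  rw [norm_one_sub_conj_mul_sq]
  have : 0 < (1 - ‖z‖ ^ 2) * (1 - ‖w‖ ^ 2) :=
    mul_pos (by nlinarith [norm_nonneg z]) (by nlinarith [norm_nonneg w])
  linarith

theorem eq_of_pseudoHypDist_eq_zero {z w : ℂ} (hz : ‖z‖ < 1) (hw : ‖w‖ < 1)
    (h : pseudoHypDist z w = 0) : z = w := by
  rw [pseudoHypDist, norm_eq_zero, div_eq_zero_iff] at h
  exact sub_eq_zero.1 (h.resolve_right (one_sub_conj_mul_ne_zero hz hw))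

/-- The strong triangle inequality in the case where one of the points is the origin, to which
`pseudoHypDist_moebius` reduces the general case. -/
theorem norm_sub_norm_le_pseudoHypDist_mul {z a : ℂ} (hz : ‖z‖ < 1) (ha : ‖a‖ < 1) :
    ‖z‖ - ‖a‖ ≤ pseudoHypDist z a * (1 - ‖z‖ * ‖a‖) := by
  have h0 := norm_pos_iff.2 (one_sub_conj_mul_ne_zero hz ha)
  have h1 : 0 ≤ 1 - ‖z‖ * ‖a‖ := by nlinarith [norm_nonneg z, norm_nonneg a]
  rw [pseudoHypDist, norm_div, div_mul_eq_mul_div, le_div_iff₀ h0]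
  refine le_of_sq_le_sq ?_ (mul_nonneg (norm_nonneg _) h1)
  rw [mul_pow, mul_pow, norm_one_sub_conj_mul_sq]
  have h2 : (‖z‖ - ‖a‖) ^ 2 ≤ ‖z - a‖ ^ 2 := by
    rw [← sq_abs]
    exact pow_le_pow_left₀ (abs_nonneg _) (abs_norm_sub_norm_le z a) 2
  have h3 : 0 ≤ (1 - ‖z‖ ^ 2) * (1 - ‖a‖ ^ 2) :=
    mul_nonneg (by nlinarith [norm_nonneg z]) (by nlinarith [norm_nonneg a])
  nlinarith

/-- The disk automorphism `z ↦ (z - b) / (1 - b̄ z)` is an isometry for `pseudoHypDist`. -/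
theorem pseudoHypDist_moebius {z a b : ℂ} (hz : ‖z‖ < 1) (ha : ‖a‖ < 1) (hb : ‖b‖ < 1) :
    pseudoHypDist ((z - b) / (1 - (starRingEnd ℂ) b * z))
      ((a - b) / (1 - (starRingEnd ℂ) b * a)) = pseudoHypDist z a := by
  have h1 := one_sub_conj_mul_ne_zero hb hz
  have h2 := one_sub_conj_mul_ne_zero hb ha
  have h3 := one_sub_conj_mul_ne_zero hz hb
  have h4 := one_sub_conj_mul_ne_zero hb hb
  have h5 := one_sub_conj_mul_ne_zero hz ha
  have e1 : (z - b) / (1 - (starRingEnd ℂ) b * z) - (a - b) / (1 - (starRingEnd ℂ) b * a) =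
      (z - a) * (1 - (starRingEnd ℂ) b * b) /
        ((1 - (starRingEnd ℂ) b * z) * (1 - (starRingEnd ℂ) b * a)) := by
    rw [div_sub_div _ _ h1 h2]; congr 1; ring
  have h6 : 1 - b * (starRingEnd ℂ) z ≠ 0 := by rwa [mul_comm]
  have e2 : 1 - (starRingEnd ℂ) ((z - b) / (1 - (starRingEnd ℂ) b * z)) *
      ((a - b) / (1 - (starRingEnd ℂ) b * a)) =
      (1 - (starRingEnd ℂ) z * a) * (1 - (starRingEnd ℂ) b * b) /
        ((1 - b * (starRingEnd ℂ) z) * (1 - (starRingEnd ℂ) b * a)) := by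
    simp only [map_div₀, map_sub, map_one, map_mul, Complex.conj_conj]
    rw [div_mul_div_comm, one_sub_div (mul_ne_zero h6 h2)]; congr 1; ring
  have h7 : ‖1 - b * (starRingEnd ℂ) z‖ = ‖1 - (starRingEnd ℂ) b * z‖ := by
    rw [mul_comm, norm_one_sub_conj_mul_comm]
  have n1 := norm_ne_zero_iff.2 h1
  have n2 := norm_ne_zero_iff.2 h2
  have n4 := norm_ne_zero_iff.2 h4
  have n5 := norm_ne_zero_iff.2 h5
  rw [pseudoHypDist, e1, e2, pseudoHypDist]
  simp only [norm_div, norm_mul, h7]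
  generalize ‖1 - (starRingEnd ℂ) b * z‖ = x1 at *
  generalize ‖1 - (starRingEnd ℂ) b * a‖ = x2 at *
  generalize ‖1 - (starRingEnd ℂ) b * b‖ = x3 at *
  generalize ‖1 - (starRingEnd ℂ) z * a‖ = x4 at *
  field_simp

/-- The strong triangle inequality for the pseudo-hyperbolic distance. -/
theorem pseudoHypDist_sub_le {z a b : ℂ} {d : ℝ} (hz : ‖z‖ < 1) (ha : ‖a‖ < 1) (hb : ‖b‖ < 1)
    (hd : pseudoHypDist a b ≤ d) :
    pseudoHypDist z b - d ≤ pseudoHypDist z a * (1 - pseudoHypDist z b * d) := by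
  have hφ : ∀ x : ℂ, ‖(x - b) / (1 - (starRingEnd ℂ) b * x)‖ = pseudoHypDist x b := by
    intro x
    rw [pseudoHypDist_comm, pseudoHypDist, norm_div, norm_div, norm_sub_rev]
  have h1 := norm_sub_norm_le_pseudoHypDist_mul
    (by rw [hφ]; exact pseudoHypDist_lt_one hz hb :
      ‖(z - b) / (1 - (starRingEnd ℂ) b * z)‖ < 1)
    (by rw [hφ]; exact pseudoHypDist_lt_one ha hb :
      ‖(a - b) / (1 - (starRingEnd ℂ) b * a)‖ < 1)
  rw [pseudoHypDist_moebius hz ha hb, hφ, hφ] at h1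
  have h2 := pseudoHypDist_lt_one hz hb
  have h3 := pseudoHypDist_lt_one hz ha
  have h4 := pseudoHypDist_nonneg z b
  have h5 := pseudoHypDist_nonneg z a
  have h6 : pseudoHypDist z a * pseudoHypDist z b ≤ 1 := by nlinarith
  nlinarith

/-! ### Counting zeros: Rouché's theorem on a bounded domain -/

/-- The zeros of `f` in `U`, with multiplicity, are exactly the members of the multiset `s`: on `U`
the function is the product of the `z - w`, `w ∈ s`, and an analytic function without zeros. -/
def HasZeros (f : ℂ → ℂ) (U : Set ℂ) (s : Multiset ℂ) : Prop :=
  (∀ w ∈ s, w ∈ U) ∧ ∃ g : ℂ → ℂ, AnalyticOnNhd ℂ g U ∧ (∀ z ∈ U, g z ≠ 0) ∧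
    ∀ z ∈ U, f z = (s.map fun w => z - w).prod * g z

theorem HasZeros.eq_zero_iff {f : ℂ → ℂ} {U : Set ℂ} {s : Multiset ℂ} (h : HasZeros f U s) {z : ℂ}
    (hz : z ∈ U) : f z = 0 ↔ z ∈ s := by
  obtain ⟨-, g, -, hg0, hf⟩ := h
  rw [hf z hz, mul_eq_zero, or_iff_left (hg0 z hz), Multiset.prod_eq_zero_iff, Multiset.mem_map]
  constructor
  · rintro ⟨w, hw, h⟩
    rwa [sub_eq_zero.1 h]
  · exact fun h => ⟨z, h, sub_self z⟩

theorem analyticAt_multiset_prod_sub (s : Multiset ℂ) (z : ℂ) :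
    AnalyticAt ℂ (fun z => (s.map fun w => z - w).prod) z := by
  induction s using Multiset.induction_on with
  | empty => simpa using analyticAt_const
  | cons w s ih =>
    simp only [Multiset.map_cons, Multiset.prod_cons]
    exact (analyticAt_id.sub analyticAt_const).mul ih

theorem AnalyticAt.logDeriv {f : ℂ → ℂ} {z : ℂ} (hf : AnalyticAt ℂ f z) (h0 : f z ≠ 0) :
    AnalyticAt ℂ (logDeriv f) z := hf.deriv.div hf h0

/-- The argument principle on a disk, for a function given in factored form. -/
theorem circleIntegral_logDeriv_eq_countP {U : Set ℂ} {c : ℂ} {r : ℝ} (hr : 0 ≤ r)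
    (hU : Metric.closedBall c r ⊆ U) {g : ℂ → ℂ} (hg : AnalyticOnNhd ℂ g U)
    (hg0 : ∀ z ∈ U, g z ≠ 0) (s : Multiset ℂ) (hs : ∀ w ∈ s, w ∉ Metric.sphere c r)
    [DecidablePred (· ∈ Metric.ball c r)] :
    (∮ z in C(c, r), logDeriv (fun z => (s.map fun w => z - w).prod * g z) z) =
      s.countP (· ∈ Metric.ball c r) * (2 * Real.pi * Complex.I) := by
  have hsU : Metric.sphere c r ⊆ U := Metric.sphere_subset_closedBall.trans hU
  induction s using Multiset.induction_on with
  | empty =>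
    simp only [Multiset.map_zero, Multiset.prod_zero, one_mul, Multiset.countP_zero, Nat.cast_zero,
      zero_mul]
    have h : ∀ z ∈ Metric.closedBall c r, AnalyticAt ℂ (logDeriv g) z :=
      fun z hz => (hg z (hU hz)).logDeriv (hg0 z (hU hz))
    exact Complex.circleIntegral_eq_zero_of_differentiable_on_off_countable hr
      Set.countable_empty (fun z hz => (h z hz).continuousAt.continuousWithinAt)
      fun z hz => (h z (Metric.ball_subset_closedBall hz.1)).differentiableAt
  | cons w s ih =>
    have hw : w ∉ Metric.sphere c r := hs w (Multiset.mem_cons_self w s)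
    have hs' : ∀ v ∈ s, v ∉ Metric.sphere c r := fun v hv => hs v (Multiset.mem_cons_of_mem hv)
    have hF : ∀ z ∈ Metric.sphere c r,
        AnalyticAt ℂ (fun z => (s.map fun w => z - w).prod * g z) z :=
      fun z hz => (analyticAt_multiset_prod_sub s z).mul (hg z (hsU hz))
    have hF0 : ∀ z ∈ Metric.sphere c r, (s.map fun w => z - w).prod * g z ≠ 0 := by
      intro z hz h
      rcases mul_eq_zero.1 h with h | h
      · obtain ⟨v, hv, hvz⟩ := Multiset.mem_map.1 (Multiset.prod_eq_zero_iff.1 h)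
        exact hs' v hv (by rwa [← sub_eq_zero.1 hvz])
      · exact hg0 z (hsU hz) h
    have hzw : ∀ z ∈ Metric.sphere c r, z - w ≠ 0 := by
      intro z hz h
      exact hw (by rwa [← sub_eq_zero.1 h])
    have hsplit : Set.EqOn
        (logDeriv (fun z => ((w ::ₘ s).map fun w => z - w).prod * g z))
        (fun z => (z - w)⁻¹ + logDeriv (fun z => (s.map fun w => z - w).prod * g z) z)
        (Metric.sphere c r) := by
      intro z hz
      simp only [Multiset.map_cons, Multiset.prod_cons, mul_assoc]
      rw [logDeriv_mul z (hzw z hz) (hF0 z hz) (by fun_prop) (hF z hz).differentiableAt]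
      congr 1
      simp [logDeriv_apply]
    rw [circleIntegral.integral_congr hr hsplit, circleIntegral.integral_add, ih hs',
      Multiset.countP_cons]
    · split_ifs with hwb
      · rw [circleIntegral.integral_sub_inv_of_mem_ball hwb]
        push_cast; ring
      · have hwc : w ∉ Metric.closedBall c r := by
          rw [← Metric.ball_union_sphere]
          exact fun h => h.elim hwb hw
        rw [Complex.circleIntegral_eq_zero_of_differentiable_on_off_countable hr
          Set.countable_empty]
        · simp
        · intro z hz
          refine ContinuousAt.continuousWithinAt (ContinuousAt.inv₀ (by fun_prop) ?_)
          exact fun h => hwc (by rwa [← sub_eq_zero.1 h])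
        · intro z hz
          refine DifferentiableAt.inv (by fun_prop) ?_
          exact fun h => hwc (by rw [← sub_eq_zero.1 h]; exact Metric.ball_subset_closedBall hz.1)
    · refine ContinuousOn.circleIntegrable hr fun z hz => ?_
      exact ContinuousAt.continuousWithinAt (ContinuousAt.inv₀ (by fun_prop) (hzw z hz))
    · refine ContinuousOn.circleIntegrable hr fun z hz => ?_
      exact ((hF z hz).logDeriv (hF0 z hz)).continuousAt.continuousWithinAt

/-- Rouché's theorem on a disk. -/
theorem HasZeros.countP_ball_eq {U : Set ℂ} (hUo : IsOpen U) {f g : ℂ → ℂ} {s t : Multiset ℂ}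
    (hf : HasZeros f U s) (hg : HasZeros g U t) {c : ℂ} {r : ℝ} (hr : 0 ≤ r)
    (hU : Metric.closedBall c r ⊆ U) (hlt : ∀ z ∈ Metric.sphere c r, ‖g z - f z‖ < ‖f z‖)
    [DecidablePred (· ∈ Metric.ball c r)] :
    s.countP (· ∈ Metric.ball c r) = t.countP (· ∈ Metric.ball c r) := by
  have hsU : Metric.sphere c r ⊆ U := Metric.sphere_subset_closedBall.trans hU
  have hf0 : ∀ z ∈ Metric.sphere c r, f z ≠ 0 := fun z hz h => by
    have := hlt z hz
    rw [h, norm_zero] at this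
    exact absurd this (not_lt.2 (norm_nonneg _))
  have hg0 : ∀ z ∈ Metric.sphere c r, g z ≠ 0 := fun z hz h => by
    have := hlt z hz
    rw [h, zero_sub, norm_neg] at this
    exact lt_irrefl _ this
  have hint : ∀ {F : ℂ → ℂ} {m : Multiset ℂ}, HasZeros F U m →
      (∀ z ∈ Metric.sphere c r, F z ≠ 0) →
      (∀ z ∈ Metric.sphere c r, AnalyticAt ℂ F z) ∧
      (∮ z in C(c, r), logDeriv F z) =
        m.countP (· ∈ Metric.ball c r) * (2 * Real.pi * Complex.I) := by
    intro F m hF hF0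
    have hm : ∀ w ∈ m, w ∉ Metric.sphere c r := fun w hw hws =>
      hF0 w hws ((hF.eq_zero_iff (hsU hws)).2 hw)
    obtain ⟨-, h, hh, hh0, hFh⟩ := hF
    have hev : ∀ z ∈ Metric.sphere c r,
        F =ᶠ[nhds z] fun z => (m.map fun w => z - w).prod * h z := fun z hz => by
      filter_upwards [hUo.mem_nhds (hsU hz)] with x hx using hFh x hx
    refine ⟨fun z hz => ?_, ?_⟩
    · exact ((analyticAt_multiset_prod_sub m z).mul (hh z (hsU hz))).congr (hev z hz).symm
    · rw [← circleIntegral_logDeriv_eq_countP hr hU hh hh0 m hm]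
      refine circleIntegral.integral_congr hr fun z hz => ?_
      simp only [logDeriv_apply]
      rw [(hev z hz).deriv_eq, (hev z hz).self_of_nhds]
  obtain ⟨hfa, hfi⟩ := hint hf hf0
  obtain ⟨hga, hgi⟩ := hint hg hg0
  -- `log (g / f)` is a primitive of the difference of the logarithmic derivatives on the circle
  have hzero : (∮ z in C(c, r), (logDeriv g z - logDeriv f z)) = 0 := by
    refine circleIntegral.integral_eq_zero_of_hasDerivWithinAt
      (f := fun z => Complex.log (g z / f z)) hr fun z hz => ?_
    have hslit : g z / f z ∈ Complex.slitPlane := by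
      have : ‖(g z - f z) / f z‖ < 1 := by
        rw [norm_div, div_lt_one (norm_pos_iff.2 (hf0 z hz))]
        exact hlt z hz
      have h := Complex.mem_slitPlane_of_norm_lt_one this
      rwa [sub_div, div_self (hf0 z hz), add_sub_cancel] at h
    have hd := ((hga z hz).differentiableAt.div (hfa z hz).differentiableAt (hf0 z hz)).hasDerivAt
    have := hd.clog hslit
    rw [← logDeriv_div z (hg0 z hz) (hf0 z hz) (hga z hz).differentiableAt
      (hfa z hz).differentiableAt]
    exact this.hasDerivWithinAt
  rw [circleIntegral.integral_sub, hfi, hgi, ← sub_mul, mul_eq_zero,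
    or_iff_left Complex.two_pi_I_ne_zero, sub_eq_zero] at hzero
  · exact_mod_cast hzero.symm
  · exact ContinuousOn.circleIntegrable hr fun z hz =>
      ((hga z hz).logDeriv (hg0 z hz)).continuousAt.continuousWithinAt
  · exact ContinuousOn.circleIntegrable hr fun z hz =>
      ((hfa z hz).logDeriv (hf0 z hz)).continuousAt.continuousWithinAt

/-- An analytic function with finitely many zeros, all of finite order, factors through them. -/
theorem exists_hasZeros_of_finite {U : Set ℂ} (hU : IsOpen U) :
    ∀ {f : ℂ → ℂ}, AnalyticOnNhd ℂ f U → (∀ z ∈ U, ¬ ∀ᶠ x in nhds z, f x = 0) →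
      {z ∈ U | f z = 0}.Finite → ∃ s, HasZeros f U s := by
  suffices H : ∀ (n : ℕ) {f : ℂ → ℂ}, AnalyticOnNhd ℂ f U →
      (∀ z ∈ U, ¬ ∀ᶠ x in nhds z, f x = 0) → {z ∈ U | f z = 0}.Finite →
      {z ∈ U | f z = 0}.ncard = n → ∃ s, HasZeros f U s from
    fun {_} hf hloc hfin => H _ hf hloc hfin rfl
  intro n
  induction n with
  | zero =>
    intro f hf _ hfin hn
    rw [Set.ncard_eq_zero hfin] at hn
    refine ⟨0, by simp, f, hf, fun z hz h => ?_, by simp⟩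
    exact Set.notMem_empty z (hn ▸ ⟨hz, h⟩)
  | succ n ih =>
    intro f hf hloc hfin hn
    obtain ⟨w, hwU, hw0⟩ : {z ∈ U | f z = 0}.Nonempty :=
      (Set.ncard_pos hfin).1 (by omega)
    obtain ⟨k, g, hg, hgw, hfg⟩ :=
      (hf w hwU).exists_eventuallyEq_pow_smul_nonzero_iff.2 (hloc w hwU)
    classical
    let F : ℂ → ℂ := fun z => if z = w then g w else f z / (z - w) ^ k
    have hFw : F =ᶠ[nhds w] g := by
      filter_upwards [hfg] with z hz
      by_cases hzw : z = w
      · simp [F, hzw]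
      · have : (z - w) ^ k ≠ 0 := pow_ne_zero _ (sub_ne_zero.2 hzw)
        simp only [F, if_neg hzw, hz, smul_eq_mul]
        field_simp
    have hFz : ∀ z ≠ w, F =ᶠ[nhds z] fun z => f z / (z - w) ^ k := by
      intro z hzw
      filter_upwards [isOpen_ne.mem_nhds hzw] with x hx
      simp [F, if_neg hx]
    have hFf : ∀ z, z ∈ U → f z = (z - w) ^ k * F z := by
      intro z hz
      by_cases hzw : z = w
      · have := hfg.self_of_nhds
        simp only [smul_eq_mul] at this
        simp [F, hzw, this]
      · have : (z - w) ^ k ≠ 0 := pow_ne_zero _ (sub_ne_zero.2 hzw)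
        simp only [F, if_neg hzw]
        field_simp
    have hFa : AnalyticOnNhd ℂ F U := by
      intro z hz
      by_cases hzw : z = w
      · rw [hzw]; exact hg.congr hFw.symm
      · refine AnalyticAt.congr ?_ (hFz z hzw).symm
        exact (hf z hz).div (by fun_prop) (pow_ne_zero _ (sub_ne_zero.2 hzw))
    have hFloc : ∀ z ∈ U, ¬ ∀ᶠ x in nhds z, F x = 0 := by
      intro z hz h
      refine hloc z hz ?_
      filter_upwards [h, hU.mem_nhds hz] with x hx hxU
      rw [hFf x hxU, hx, mul_zero]
    have hset : {z ∈ U | F z = 0} = {z ∈ U | f z = 0} \ {w} := by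
      ext z
      simp only [Set.mem_ofPred_eq, Set.mem_sdiff, Set.mem_singleton_iff]
      constructor
      · rintro ⟨hz, h⟩
        refine ⟨⟨hz, by rw [hFf z hz, h, mul_zero]⟩, ?_⟩
        rintro rfl
        exact hgw (by simpa [F] using h)
      · rintro ⟨⟨hz, h⟩, hzw⟩
        exact ⟨hz, by simp [F, if_neg hzw, h]⟩
    obtain ⟨s, hsU, G, hG, hG0, hFG⟩ := ih hFa hFloc (hset ▸ hfin.sdiff)
      (by
        have hw : w ∈ {z | z ∈ U ∧ f z = 0} := ⟨hwU, hw0⟩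
        rw [hset, Set.ncard_sdiff_singleton_of_mem hw, hn]
        rfl)
    refine ⟨Multiset.replicate k w + s, ?_, G, hG, hG0, fun z hz => ?_⟩
    · intro v hv
      rcases Multiset.mem_add.1 hv with hv | hv
      · rwa [Multiset.eq_of_mem_replicate hv]
      · exact hsU v hv
    · rw [hFf z hz, hFG z hz]
      simp [mul_assoc]

/-- A function analytic on the closure of a bounded domain and without zeros on its boundary has
finitely many zeros in the domain. -/
theorem exists_hasZeros {K : Set ℂ} (hK : IsOpen K) (hKc : IsPreconnected K)
    (hKb : Bornology.IsBounded K) {f : ℂ → ℂ} (hf : AnalyticOnNhd ℂ f (closure K))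
    (hf0 : ∀ z ∈ frontier K, f z ≠ 0) : ∃ s, HasZeros f K s := by
  rcases K.eq_empty_or_nonempty with rfl | hne
  · exact ⟨0, by simp, f, by simp [AnalyticOnNhd], by simp, by simp⟩
  have hfr : (frontier K).Nonempty := by
    rw [nonempty_frontier_iff]
    refine ⟨hne, fun h => ?_⟩
    exact NormedSpace.unbounded_univ ℝ ℂ (h ▸ hKb)
  obtain ⟨p, hp⟩ := hfr
  have hpre := hKc.closure
  have hcpt : IsCompact (closure K) := hKb.isCompact_closure
  have hfreq : ∀ z ∈ closure K, ¬ ∃ᶠ x in nhdsWithin z {z}ᶜ, f x = 0 := fun z hz h =>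
    hf0 p hp (hf.eqOn_zero_of_preconnected_of_frequently_eq_zero hpre hz h
      (frontier_subset_closure hp))
  refine exists_hasZeros_of_finite hK (hf.mono subset_closure) (fun z hz h => ?_) ?_
  · exact hfreq z (subset_closure hz) (h.filter_mono nhdsWithin_le_nhds).frequently
  · by_contra hinf
    obtain ⟨z, hz, hacc⟩ := Set.Infinite.exists_accPt_of_subset_isCompact hinf hcpt
      (fun z hz => subset_closure hz.1)
    rw [accPt_iff_frequently_nhdsNE] at hacc
    exact hfreq z hz (hacc.mono fun x hx => hx.2)

theorem Multiset.card_eq_sum_countP_of_mem_unique {α ι : Type*} (s : Multiset α) (F : Finset ι)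
    (p : ι → α → Prop) [∀ i, DecidablePred (p i)] (h : ∀ x ∈ s, ∃! i, i ∈ F ∧ p i x) :
    Multiset.card s = ∑ i ∈ F, s.countP (p i) := by
  induction s using Multiset.induction_on with
  | empty => simp
  | cons x s ih =>
    obtain ⟨i, ⟨hiF, hix⟩, huniq⟩ := h x (Multiset.mem_cons_self x s)
    simp only [Multiset.card_cons, Multiset.countP_cons, Finset.sum_add_distrib]
    rw [ih fun y hy => h y (Multiset.mem_cons_of_mem hy)]
    congr 1
    rw [Finset.sum_eq_single i]
    · simp [hix]
    · intro j hj hji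
      rw [if_neg]
      exact fun hjx => hji (huniq j ⟨hj, hjx⟩)
    · exact fun h => absurd hiF h

/-- The number of zeros in a bounded open set is stable under small perturbations of a function
without zeros on the boundary: surround the zeros by small disks and use Rouché's theorem in each
of them. -/
theorem HasZeros.exists_card_eq_of_norm_sub_lt {K : Set ℂ} (hK : IsOpen K)
    (hKb : Bornology.IsBounded K) {f : ℂ → ℂ} (hf : ContinuousOn f (closure K))
    (hf0 : ∀ z ∈ frontier K, f z ≠ 0) {s : Multiset ℂ} (hs : HasZeros f K s) :
    ∃ ε > 0, ∀ (g : ℂ → ℂ) (t : Multiset ℂ), HasZeros g K t →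
      (∀ z ∈ K, ‖g z - f z‖ < ε) → Multiset.card t = Multiset.card s := by
  classical
  obtain ⟨r, hr, hrK, hdisj⟩ : ∃ r > 0, (∀ w ∈ s.toFinset, Metric.closedBall w r ⊆ K) ∧
      ∀ w ∈ s.toFinset, ∀ v ∈ s.toFinset, w ≠ v →
        Disjoint (Metric.ball w r) (Metric.ball v r) := by
    have h1 : ∀ᶠ r in nhdsWithin (0 : ℝ) (Set.Ioi 0),
        ∀ w ∈ s.toFinset, Metric.closedBall w r ⊆ K := by
      rw [Filter.eventually_all_finset]
      intro w hw
      obtain ⟨ε, hε, h⟩ := Metric.isOpen_iff.1 hK w (hs.1 w (Multiset.mem_toFinset.1 hw))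
      filter_upwards [nhdsWithin_le_nhds (Iio_mem_nhds hε)] with r hr
      exact (Metric.closedBall_subset_ball hr).trans h
    have h2 : ∀ᶠ r in nhdsWithin (0 : ℝ) (Set.Ioi 0), ∀ w ∈ s.toFinset, ∀ v ∈ s.toFinset, w ≠ v →
        Disjoint (Metric.ball w r) (Metric.ball v r) := by
      rw [Filter.eventually_all_finset]
      intro w _
      rw [Filter.eventually_all_finset]
      intro v _
      by_cases hwv : w = v
      · simp [hwv]
      · filter_upwards [nhdsWithin_le_nhds (Iio_mem_nhds (half_pos (dist_pos.2 hwv)))] with r hr _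
        have hr' : r < dist w v / 2 := hr
        exact Metric.ball_disjoint_ball (by linarith)
    obtain ⟨r, h, h', hr⟩ := (h1.and (h2.and self_mem_nhdsWithin)).exists
    exact ⟨r, hr, h, h'⟩
  -- away from the disks, `f` is bounded below
  let C : Set ℂ := closure K \ ⋃ w ∈ s.toFinset, Metric.ball w r
  have hC : IsCompact C := hKb.isCompact_closure.diff
    (isOpen_biUnion fun w _ => Metric.isOpen_ball)
  have hCf : ∀ z ∈ C, 0 < ‖f z‖ := by
    intro z hz
    rw [norm_pos_iff]
    intro h0
    by_cases hzK : z ∈ K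
    · have := (hs.eq_zero_iff hzK).1 h0
      exact hz.2 (Set.mem_biUnion (Multiset.mem_toFinset.2 this) (Metric.mem_ball_self hr))
    · exact hf0 z (by rw [hK.frontier_eq]; exact ⟨hz.1, hzK⟩) h0
  obtain ⟨ε, hε, hCε⟩ : ∃ ε > 0, ∀ z ∈ C, ε ≤ ‖f z‖ :=
    hC.exists_forall_le' (hf.norm.mono Set.sdiff_subset) hCf
  refine ⟨ε, hε, fun g t ht hgf => ?_⟩
  have hmem : ∀ m : Multiset ℂ, (∀ x ∈ m, ∃ w ∈ s.toFinset, x ∈ Metric.ball w r) →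
      Multiset.card m = ∑ w ∈ s.toFinset, m.countP (· ∈ Metric.ball w r) := by
    intro m hm
    refine Multiset.card_eq_sum_countP_of_mem_unique m _ (fun w x => x ∈ Metric.ball w r) ?_
    intro x hx
    obtain ⟨w, hw, hxw⟩ := hm x hx
    refine ⟨w, ⟨hw, hxw⟩, fun v hv => ?_⟩
    by_contra hne
    exact Set.disjoint_left.1 (hdisj v hv.1 w hw hne) hv.2 hxw
  rw [hmem s fun x hx => ⟨x, Multiset.mem_toFinset.2 hx, Metric.mem_ball_self hr⟩, hmem t]
  · refine Finset.sum_congr rfl fun w hw => ?_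
    refine (hs.countP_ball_eq hK ht hr.le (hrK w hw) fun z hz => ?_).symm
    have hzK : z ∈ K := hrK w hw (Metric.sphere_subset_closedBall hz)
    refine (hgf z hzK).trans_le (hCε z ⟨subset_closure hzK, ?_⟩)
    simp only [Set.mem_iUnion, not_exists]
    intro v hv hzv
    by_cases hvw : v = w
    · rw [hvw] at hzv
      exact (Metric.mem_ball.1 hzv).ne (Metric.mem_sphere.1 hz)
    · -- the sphere around `w` lies in the closure of the ball around `w`
      have h1 : z ∈ closure (Metric.ball w r) := by
        rw [closure_ball w hr.ne']; exact Metric.sphere_subset_closedBall hz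
      obtain ⟨y, hy⟩ := mem_closure_iff.1 h1 _ Metric.isOpen_ball hzv
      exact Set.disjoint_left.1 (hdisj v hv w hw hvw) hy.1 hy.2
  · intro x hx
    by_contra hcon
    have hxK := ht.1 x hx
    have hxC : x ∈ C := by
      refine ⟨subset_closure hxK, ?_⟩
      simpa using hcon
    have h1 := hgf x hxK
    rw [(ht.eq_zero_iff hxK).2 hx, zero_sub, norm_neg] at h1
    exact absurd (hCε x hxC) (not_le.2 h1)

/-- Rouché's theorem on a bounded domain, by deforming `f` into `f + h`. -/
theorem HasZeros.card_eq_of_norm_lt {K : Set ℂ} (hK : IsOpen K) (hKc : IsPreconnected K)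
    (hKb : Bornology.IsBounded K) {f h : ℂ → ℂ} (hf : AnalyticOnNhd ℂ f (closure K))
    (hh : AnalyticOnNhd ℂ h (closure K)) (hlt : ∀ z ∈ frontier K, ‖h z‖ < ‖f z‖)
    {s t : Multiset ℂ} (hs : HasZeros f K s) (ht : HasZeros (fun z => f z + h z) K t) :
    Multiset.card s = Multiset.card t := by
  let Φ : unitInterval → ℂ → ℂ := fun τ z => f z + (τ : ℝ) * h z
  have hΦa : ∀ τ, AnalyticOnNhd ℂ (Φ τ) (closure K) := fun τ z hz =>
    (hf z hz).add (analyticAt_const.mul (hh z hz))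
  have hΦ0 : ∀ τ, ∀ z ∈ frontier K, Φ τ z ≠ 0 := by
    intro τ z hz h0
    have h1 : ‖f z‖ = τ * ‖h z‖ := by
      rw [eq_neg_of_add_eq_zero_left h0, norm_neg, norm_mul, Complex.norm_real,
        Real.norm_of_nonneg τ.2.1]
    have h2 := mul_le_of_le_one_left (norm_nonneg (h z)) τ.2.2
    linarith [hlt z hz]
  choose Z hZ using fun τ => exists_hasZeros hK hKc hKb (hΦa τ) (hΦ0 τ)
  obtain ⟨M, hM⟩ := hKb.isCompact_closure.exists_bound_of_continuousOn hh.continuousOn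
  have hloc : IsLocallyConstant fun τ => Multiset.card (Z τ) := by
    rw [IsLocallyConstant.iff_eventually_eq]
    intro τ
    obtain ⟨ε, hε, H⟩ :=
      (hZ τ).exists_card_eq_of_norm_sub_lt hK hKb (hΦa τ).continuousOn (hΦ0 τ)
    have hev : ∀ᶠ σ : unitInterval in nhds τ, |(σ : ℝ) - τ| * (|M| + 1) < ε := by
      have hcont : Continuous fun σ : unitInterval => |(σ : ℝ) - τ| * (|M| + 1) := by fun_prop
      exact hcont.continuousAt.eventually_lt continuousAt_const (by simpa using hε)
    filter_upwards [hev] with σ hσ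
    refine H _ _ (hZ σ) fun z hz => ?_
    have e : Φ σ z - Φ τ z = ((σ - τ : ℝ) : ℂ) * h z := by simp only [Φ]; push_cast; ring
    rw [e, norm_mul, Complex.norm_real, Real.norm_eq_abs]
    refine lt_of_le_of_lt (mul_le_mul_of_nonneg_left ?_ (abs_nonneg _)) hσ
    linarith [hM z (subset_closure hz), le_abs_self M]
  have hends := hloc.apply_eq_of_preconnectedSpace 0 1
  have huniq : ∀ τ m, HasZeros (Φ τ) K m → Multiset.card m = Multiset.card (Z τ) := by
    intro τ m hm
    obtain ⟨ε, hε, H⟩ :=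
      (hZ τ).exists_card_eq_of_norm_sub_lt hK hKb (hΦa τ).continuousOn (hΦ0 τ)
    exact H _ _ hm fun z _ => by simpa using hε
  rw [huniq 0 s (by simpa [Φ] using hs), huniq 1 t (by simpa [Φ] using ht)]
  exact hends

/-! ### Blaschke products -/

/-- The Blaschke factor with zero `a`, where `a = 0` is allowed and gives the function `z`. -/
noncomputable def extendedBlaschkeFactor (a z : ℂ) : ℂ :=
  open Classical in if a = 0 then z else blaschkeFactor a z

/-- The quotient of `extendedBlaschkeFactor a` by `z - a`. -/
noncomputable def blaschkeCofactor (a z : ℂ) : ℂ :=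
  open Classical in if a = 0 then 1 else -((‖a‖ : ℂ) / a) / (1 - (starRingEnd ℂ) a * z)

theorem extendedBlaschkeFactor_eq (a z : ℂ) :
    extendedBlaschkeFactor a z = (z - a) * blaschkeCofactor a z := by
  unfold extendedBlaschkeFactor blaschkeCofactor blaschkeFactor
  split_ifs with h
  · simp [h]
  · ring

theorem analyticAt_blaschkeCofactor {a z : ℂ} (ha : ‖a‖ < 1) (hz : ‖z‖ < 1) :
    AnalyticAt ℂ (blaschkeCofactor a) z := by
  unfold blaschkeCofactor
  split_ifs with h
  · exact analyticAt_const
  · exact analyticAt_const.div (by fun_prop) (one_sub_conj_mul_ne_zero ha hz)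

theorem blaschkeCofactor_ne_zero {a z : ℂ} (ha : ‖a‖ < 1) (hz : ‖z‖ < 1) :
    blaschkeCofactor a z ≠ 0 := by
  unfold blaschkeCofactor
  split_ifs with h
  · exact one_ne_zero
  · refine div_ne_zero (neg_ne_zero.2 (div_ne_zero ?_ h)) (one_sub_conj_mul_ne_zero ha hz)
    simpa using h

theorem analyticAt_extendedBlaschkeFactor {a z : ℂ} (ha : ‖a‖ < 1) (hz : ‖z‖ < 1) :
    AnalyticAt ℂ (extendedBlaschkeFactor a) z := by
  rw [funext (extendedBlaschkeFactor_eq a)]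
  exact (analyticAt_id.sub analyticAt_const).mul (analyticAt_blaschkeCofactor ha hz)

theorem norm_extendedBlaschkeFactor (a z : ℂ) :
    ‖extendedBlaschkeFactor a z‖ = pseudoHypDist z a := by
  unfold extendedBlaschkeFactor blaschkeFactor
  split_ifs with h
  · simp [h, pseudoHypDist]
  · have h1 : ‖a‖ ≠ 0 := norm_ne_zero_iff.2 h
    rw [pseudoHypDist_comm, pseudoHypDist, norm_mul, norm_div (‖a‖ : ℂ), Complex.norm_real,
      norm_norm, div_self h1, one_mul]

theorem norm_extendedBlaschkeFactor_sub_one_le {a z : ℂ} {r : ℝ} (ha : ‖a‖ < 1) (hz : ‖z‖ ≤ r)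
    (hr : r < 1) : ‖extendedBlaschkeFactor a z - 1‖ ≤ 2 / (1 - r) * (1 - ‖a‖) := by
  have hr0 : 0 ≤ r := (norm_nonneg z).trans hz
  have hr1 : 0 < 1 - r := by linarith
  unfold extendedBlaschkeFactor blaschkeFactor
  split_ifs with h
  · have h1 : ‖z - 1‖ ≤ 2 := (norm_sub_le _ _).trans (by rw [norm_one]; linarith)
    rw [h, norm_zero, sub_zero, mul_one, le_div_iff₀ hr1]
    nlinarith [norm_nonneg (z - 1)]
  · have hz1 := hz.trans_lt hr
    have hne := one_sub_conj_mul_ne_zero ha hz1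
    have ha0 : 0 < ‖a‖ := norm_pos_iff.2 h
    have haa : (starRingEnd ℂ) a * a = (‖a‖ : ℂ) ^ 2 := Complex.conj_mul' a
    have e : (‖a‖ : ℂ) / a * ((a - z) / (1 - (starRingEnd ℂ) a * z)) - 1 =
        -((1 - (‖a‖ : ℂ)) * (a + ‖a‖ * z)) / (a * (1 - (starRingEnd ℂ) a * z)) := by
      rw [div_mul_div_comm, div_sub_one (mul_ne_zero h hne)]
      congr 1
      linear_combination z * haa
    have h1 : ‖(1 - (‖a‖ : ℂ))‖ = 1 - ‖a‖ := by
      rw [← Complex.ofReal_one, ← Complex.ofReal_sub, Complex.norm_real,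
        Real.norm_of_nonneg (by linarith)]
    have h2 : ‖a + ‖a‖ * z‖ ≤ ‖a‖ * 2 := by
      refine (norm_add_le _ _).trans ?_
      rw [norm_mul, Complex.norm_real, norm_norm]
      nlinarith
    have h3 : 1 - r ≤ ‖1 - (starRingEnd ℂ) a * z‖ := by
      have := norm_sub_norm_le (1 : ℂ) ((starRingEnd ℂ) a * z)
      rw [norm_one, norm_mul, RCLike.norm_conj] at this
      nlinarith [norm_nonneg z]
    rw [e, norm_div, norm_neg, norm_mul, norm_mul, h1,
      div_le_iff₀ (mul_pos ha0 (hr1.trans_le h3))]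
    calc (1 - ‖a‖) * ‖a + ‖a‖ * z‖ ≤ (1 - ‖a‖) * (‖a‖ * 2) :=
          mul_le_mul_of_nonneg_left h2 (by linarith)
      _ = 2 / (1 - r) * (1 - ‖a‖) * (‖a‖ * (1 - r)) := by field_simp
      _ ≤ 2 / (1 - r) * (1 - ‖a‖) * (‖a‖ * ‖1 - (starRingEnd ℂ) a * z‖) := by
          have h4 : 0 ≤ 1 - ‖a‖ := by linarith
          gcongr

section Product

variable {J : Type*} {a : J → ℂ}

theorem summable_norm_extendedBlaschkeFactor_sub_one (ha : ∀ j, ‖a j‖ < 1)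
    (hs : Summable fun j => 1 - ‖a j‖) {z : ℂ} (hz : ‖z‖ < 1) :
    Summable fun j => ‖extendedBlaschkeFactor (a j) z - 1‖ :=
  (hs.mul_left (2 / (1 - ‖z‖))).of_nonneg_of_le (fun _ => norm_nonneg _)
    fun j => norm_extendedBlaschkeFactor_sub_one_le (ha j) le_rfl hz

theorem multipliable_extendedBlaschkeFactor (ha : ∀ j, ‖a j‖ < 1)
    (hs : Summable fun j => 1 - ‖a j‖) {z : ℂ} (hz : ‖z‖ < 1) :
    Multipliable fun j => extendedBlaschkeFactor (a j) z := by
  simpa using multipliable_one_add_of_summable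
    (summable_norm_extendedBlaschkeFactor_sub_one ha hs hz)

theorem tprod_extendedBlaschkeFactor_ne_zero (ha : ∀ j, ‖a j‖ < 1)
    (hs : Summable fun j => 1 - ‖a j‖) {z : ℂ} (hz : ‖z‖ < 1) (hza : ∀ j, a j ≠ z) :
    ∏' j, extendedBlaschkeFactor (a j) z ≠ 0 := by
  have := tprod_one_add_ne_zero_of_summable (f := fun j => extendedBlaschkeFactor (a j) z - 1)
    (fun j => ?_) (summable_norm_extendedBlaschkeFactor_sub_one ha hs hz)
  · simpa using this
  · rw [add_sub_cancel, extendedBlaschkeFactor_eq]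
    exact mul_ne_zero (sub_ne_zero.2 (hza j).symm) (blaschkeCofactor_ne_zero (ha j) hz)

theorem analyticOnNhd_tprod_extendedBlaschkeFactor (ha : ∀ j, ‖a j‖ < 1)
    (hs : Summable fun j => 1 - ‖a j‖) :
    AnalyticOnNhd ℂ (fun z => ∏' j, extendedBlaschkeFactor (a j) z) unitDiskC := by
  intro z hz
  obtain ⟨r, hzr, hr⟩ := exists_between (mem_unitDiskC.1 hz)
  have hball : ∀ x ∈ Metric.ball (0 : ℂ) r, ‖x‖ < r := fun x hx => by simpa using hx
  have hφ : ∀ j, DifferentiableOn ℂ (extendedBlaschkeFactor (a j)) (Metric.ball 0 r) :=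
    fun j x hx => (analyticAt_extendedBlaschkeFactor (ha j)
      ((hball x hx).trans hr)).differentiableAt.differentiableWithinAt
  have h1 := Summable.hasProdLocallyUniformlyOn_one_add
    (f := fun j x => extendedBlaschkeFactor (a j) x - 1) (Metric.isOpen_ball (x := (0 : ℂ)) (ε := r))
    (hs.mul_left (2 / (1 - r)))
    (Filter.Eventually.of_forall fun j x hx =>
      norm_extendedBlaschkeFactor_sub_one_le (ha j) (hball x hx).le hr)
    (fun j => (hφ j).continuousOn.sub continuousOn_const)
  simp only [add_sub_cancel] at h1
  rw [hasProdLocallyUniformlyOn_iff_tendstoLocallyUniformlyOn] at h1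
  have h2 := h1.differentiableOn (Filter.Eventually.of_forall fun s =>
    DifferentiableOn.fun_finsetProd fun j _ => hφ j) Metric.isOpen_ball
  exact h2.analyticAt (Metric.isOpen_ball.mem_nhds (by simpa using hzr))

end Product

/-- `a` lists the zeros of the Blaschke product `B` in the disk, with multiplicity and the origin
included, and `B` is a unimodular multiple of the corresponding product. -/
def IsBlaschkeZeroFamily (B : ℂ → ℂ) {I : Type} (a : I → ℂ) : Prop :=
  (∀ i, ‖a i‖ < 1) ∧ (Summable fun i => 1 - ‖a i‖) ∧
    ∃ c : ℂ, ‖c‖ = 1 ∧ ∀ z ∈ unitDiskC, B z = c * ∏' i, extendedBlaschkeFactor (a i) z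

theorem IsBlaschkeProduct.exists_zeroFamily {B : ℂ → ℂ} (hB : IsBlaschkeProduct B) :
    ∃ (I : Type) (a : I → ℂ), IsBlaschkeZeroFamily B a := by
  obtain ⟨c, m, ι, -, α, hc, hα, hsum, hB⟩ := hB
  refine ⟨Fin m ⊕ ι, Sum.elim (fun _ => 0) α, ?_, ?_, c, hc, fun z hz => ?_⟩
  · rintro (i | i)
    · simp
    · exact mem_unitDiskC.1 (hα i).2
  · refine (HasSum.sum (hasSum_fintype _) (b := ∑' n, (1 - ‖α n‖)) ?_).summable
    simpa [Function.comp_def] using hsum.hasSum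
  · obtain ⟨P, hP, hBz⟩ := hB z hz
    have h : HasProd (fun i => extendedBlaschkeFactor (Sum.elim (fun _ : Fin m => (0 : ℂ)) α i) z)
        (z ^ m * P) := by
      refine HasProd.sum ?_ ?_
      · simpa [Function.comp_def, extendedBlaschkeFactor] using
          hasProd_fintype fun _ : Fin m => z
      · simpa [Function.comp_def, extendedBlaschkeFactor, (hα _).1] using hP
    rw [hBz, h.tprod_eq, mul_assoc]

namespace IsBlaschkeZeroFamily

variable {B : ℂ → ℂ} {I : Type} {a : I → ℂ}

theorem analyticOnNhd (h : IsBlaschkeZeroFamily B a) : AnalyticOnNhd ℂ B unitDiskC := by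
  obtain ⟨ha, hs, c, -, hB⟩ := h
  intro z hz
  refine (analyticAt_const.mul
    (analyticOnNhd_tprod_extendedBlaschkeFactor ha hs z hz)).congr (f := fun z => c * _) ?_
  filter_upwards [Metric.isOpen_ball.mem_nhds hz] with x hx using (hB x hx).symm

theorem hasProd_norm (h : IsBlaschkeZeroFamily B a) {z : ℂ} (hz : z ∈ unitDiskC) :
    HasProd (fun i => pseudoHypDist z (a i)) ‖B z‖ := by
  obtain ⟨ha, hs, c, hc, hB⟩ := h
  have h1 := (multipliable_extendedBlaschkeFactor ha hs (mem_unitDiskC.1 hz)).hasProd.norm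
  simpa only [hB z hz, norm_mul, hc, one_mul, norm_extendedBlaschkeFactor] using h1

theorem norm_le_pseudoHypDist (h : IsBlaschkeZeroFamily B a) {z : ℂ} (hz : z ∈ unitDiskC) (i : I) :
    ‖B z‖ ≤ pseudoHypDist z (a i) := by
  classical
  refine le_of_tendsto (h.hasProd_norm hz) ?_
  simp only [SummationFilter.unconditional_filter]
  filter_upwards [Filter.eventually_ge_atTop {i}] with S hS
  have hi : i ∈ S := hS (Finset.mem_singleton_self i)
  rw [← Finset.mul_prod_erase S _ hi]
  refine mul_le_of_le_one_right (pseudoHypDist_nonneg _ _)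
    (Finset.prod_le_one (fun j _ => pseudoHypDist_nonneg _ _) fun j _ => ?_)
  exact (pseudoHypDist_lt_one (mem_unitDiskC.1 hz) (h.1 j)).le

theorem apply_eq_zero (h : IsBlaschkeZeroFamily B a) (i : I) : B (a i) = 0 := by
  have h1 := h.norm_le_pseudoHypDist (mem_unitDiskC.2 (h.1 i)) i
  rw [pseudoHypDist, sub_self, zero_div, norm_zero] at h1
  exact norm_le_zero_iff.1 h1

/-- In a set whose closure lies in the open disk, a Blaschke product has finitely many zeros, and
their number with multiplicity is that of the listed ones. -/
theorem exists_hasZeros (h : IsBlaschkeZeroFamily B a) {K : Set ℂ} (hK : closure K ⊆ unitDiskC) :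
    Finite {i // a i ∈ K} ∧
      ∃ s, HasZeros B K s ∧ Multiset.card s = Nat.card {i // a i ∈ K} := by
  obtain ⟨ha, hs, c, hc, hB⟩ := h
  have hKD : K ⊆ unitDiskC := subset_closure.trans hK
  have hcpt : IsCompact (closure K) :=
    (Metric.isBounded_ball.subset hKD).isCompact_closure
  obtain ⟨ε, hε, hKε⟩ : ∃ ε > 0, ∀ z ∈ closure K, ε ≤ 1 - ‖z‖ :=
    hcpt.exists_forall_le' (by fun_prop) fun z hz => sub_pos.2 (mem_unitDiskC.1 (hK hz))
  let S : Set I := {i | a i ∈ K}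
  have hfin : S.Finite := by
    have h1 := hs.tendsto_cofinite_zero.eventually_lt_const hε
    refine Set.Finite.subset h1 fun i hi => ?_
    exact not_lt.2 (hKε _ (subset_closure hi))
  have : Fintype S := hfin.fintype
  refine ⟨hfin, (Finset.univ : Finset S).val.map fun i : S => a i, ⟨?_, ?_⟩, ?_⟩
  · intro w hw
    obtain ⟨i, -, rfl⟩ := Multiset.mem_map.1 hw
    exact i.2
  · have haR : ∀ i : (Sᶜ : Set I), ‖a i‖ < 1 := fun i => ha i
    have hsR : Summable fun i : (Sᶜ : Set I) => 1 - ‖a i‖ := hs.subtype _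
    let R : ℂ → ℂ := fun z => ∏' i : (Sᶜ : Set I), extendedBlaschkeFactor (a i) z
    refine ⟨fun z => c * ((∏ i : S, blaschkeCofactor (a i) z) * R z), ?_, ?_, ?_⟩
    · intro z hz
      refine analyticAt_const.mul (AnalyticAt.mul (Finset.analyticAt_fun_prod _ fun i _ =>
        analyticAt_blaschkeCofactor (ha i) (mem_unitDiskC.1 (hKD hz))) ?_)
      exact analyticOnNhd_tprod_extendedBlaschkeFactor haR hsR z (hKD hz)
    · intro z hz
      have hz1 := mem_unitDiskC.1 (hKD hz)
      refine mul_ne_zero (norm_ne_zero_iff.1 (by rw [hc]; exact one_ne_zero))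
        (mul_ne_zero (Finset.prod_ne_zero_iff.2 fun i _ =>
          blaschkeCofactor_ne_zero (ha i) hz1) ?_)
      refine tprod_extendedBlaschkeFactor_ne_zero haR hsR hz1 fun i hi => ?_
      exact i.2 (show a i ∈ K by rwa [hi])
    · intro z hz
      have hz1 := mem_unitDiskC.1 (hKD hz)
      have hprod := Multipliable.tprod_mul_tprod_compl
        (f := fun i => extendedBlaschkeFactor (a i) z) (s := S)
        (multipliable_extendedBlaschkeFactor (a := fun i : S => a i)
          (fun i => ha i) (hs.subtype _) hz1)
        (multipliable_extendedBlaschkeFactor haR hsR hz1)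
      have hF : ∏' i : S, extendedBlaschkeFactor (a i) z =
          (∏ i : S, (z - a i)) * ∏ i : S, blaschkeCofactor (a i) z := by
        rw [tprod_fintype, ← Finset.prod_mul_distrib]
        simp only [extendedBlaschkeFactor_eq]
      have hM : (((Finset.univ : Finset S).val.map fun i : S => a i).map fun w => z - w).prod =
          ∏ i : S, (z - a i) := by
        rw [Multiset.map_map]; rfl
      rw [hB z (hKD hz), ← hprod, hF, hM]
      simp only [R]
      ring
  · rw [Multiset.card_map]
    exact (Nat.card_eq_fintype_card (α := S)).symm

end IsBlaschkeZeroFamily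

/-! ### Pairing the zeros of two nearby Blaschke products -/

theorem isOpen_levelSet {B : ℂ → ℂ} (hB : AnalyticOnNhd ℂ B unitDiskC) (θ : ℝ) :
    IsOpen (levelSet B θ) :=
  hB.continuousOn.norm.isOpen_inter_preimage Metric.isOpen_ball isOpen_Iio

theorem connectedComponentIn_levelSet_subset {B : ℂ → ℂ} {θ : ℝ} {z : ℂ} :
    connectedComponentIn (levelSet B θ) z ⊆ unitDiskC :=
  (connectedComponentIn_subset _ _).trans fun _ h => h.1

theorem le_norm_of_mem_frontier_component {B : ℂ → ℂ} (hB : AnalyticOnNhd ℂ B unitDiskC) {θ : ℝ}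
    {z x : ℂ} (hx : x ∈ unitDiskC)
    (hfr : x ∈ frontier (connectedComponentIn (levelSet B θ) z)) : θ ≤ ‖B x‖ := by
  by_contra! hlt
  have hxΩ : x ∈ levelSet B θ := ⟨hx, hlt⟩
  have hopen := isOpen_levelSet hB θ
  -- the component of `x` is a neighbourhood of `x`, so it meets, hence equals, that of `z`
  obtain ⟨y, hy1, hy2⟩ := mem_closure_iff.1 (frontier_subset_closure hfr) _
    (hopen.connectedComponentIn (x := x)) (mem_connectedComponentIn hxΩ)
  have h : connectedComponentIn (levelSet B θ) z = connectedComponentIn (levelSet B θ) x :=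
    (connectedComponentIn_eq hy2).trans (connectedComponentIn_eq hy1).symm
  rw [(hopen.connectedComponentIn).frontier_eq] at hfr
  exact hfr.2 (h ▸ mem_connectedComponentIn hxΩ)

/-- By Rouché's theorem, `B` and `Bt` have the same number of zeros in each component of
`Ω_{B,η}`. -/
theorem card_zeros_component_eq {B Bt : ℂ → ℂ} {I J : Type} {a : I → ℂ} {b : J → ℂ} {η : ℝ}
    (ha : IsBlaschkeZeroFamily B a) (hb : IsBlaschkeZeroFamily Bt b)
    (hclose : ∀ z ∈ unitDiskC, ‖Bt z - B z‖ < η) {z : ℂ}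
    (hz : closure (connectedComponentIn (levelSet B η) z) ⊆ unitDiskC) :
    Nonempty ({i // a i ∈ connectedComponentIn (levelSet B η) z} ≃
      {j // b j ∈ connectedComponentIn (levelSet B η) z}) := by
  obtain ⟨hfa, s, hs, hsc⟩ := ha.exists_hasZeros hz
  obtain ⟨hfb, t, ht, htc⟩ := hb.exists_hasZeros hz
  have hcard : Multiset.card s = Multiset.card t := by
    refine hs.card_eq_of_norm_lt (h := fun z => Bt z - B z)
      (isOpen_levelSet ha.analyticOnNhd η).connectedComponentIn
      isPreconnected_connectedComponentIn
      (Metric.isBounded_ball.subset connectedComponentIn_levelSet_subset)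
      (ha.analyticOnNhd.mono hz)
      (fun x hx => (hb.analyticOnNhd x (hz hx)).sub (ha.analyticOnNhd x (hz hx))) ?_
      (by simpa using ht)
    intro x hx
    have hxD := hz (frontier_subset_closure hx)
    exact (hclose x hxD).trans_le (le_norm_of_mem_frontier_component ha.analyticOnNhd hxD hx)
  rw [hsc, htc] at hcard
  exact (Finite.card_eq).1 hcard

theorem pseudoHypDist_le_componentDiam {B : ℂ → ℂ} {η : ℝ} {z w : ℂ} (hz : z ∈ levelSet B η)
    (hw : w ∈ connectedComponentIn (levelSet B η) z) : pseudoHypDist z w ≤ componentDiam B η := by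
  refine le_csSup ⟨1, ?_⟩ ⟨z, hz, w, hw, rfl⟩
  rintro r ⟨z, hz, w, hw, rfl⟩
  exact (pseudoHypDist_lt_one (mem_unitDiskC.1 hz.1)
    (mem_unitDiskC.1 (connectedComponentIn_levelSet_subset hw))).le

/-- The zeros of two Blaschke products at distance less than `η` can be paired, each one with a zero
in the same component of `Ω_{B,η}`. -/
theorem exists_equiv_zeros {B Bt : ℂ → ℂ} {I J : Type} {a : I → ℂ} {b : J → ℂ} {η : ℝ}
    (ha : IsBlaschkeZeroFamily B a) (hb : IsBlaschkeZeroFamily Bt b)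
    (hη : 0 < η) (hη1 : η < 1) (hB : HasPropertyB B)
    (hclose : ∀ z ∈ unitDiskC, ‖Bt z - B z‖ < η) :
    ∃ e : I ≃ J, ∀ i, pseudoHypDist (a i) (b (e i)) ≤ componentDiam B η := by
  have haΩ : ∀ i, a i ∈ levelSet B η := fun i =>
    ⟨mem_unitDiskC.2 (ha.1 i), by rwa [ha.apply_eq_zero, norm_zero]⟩
  have hbΩ : ∀ j, b j ∈ levelSet B η := fun j => by
    have hj := mem_unitDiskC.2 (hb.1 j)
    refine ⟨hj, ?_⟩
    have := hclose _ hj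
    rwa [hb.apply_eq_zero, zero_sub, norm_neg] at this
  let κ : ℂ → Set ℂ := connectedComponentIn (levelSet B η)
  have hκ : ∀ {x z : ℂ}, x ∈ levelSet B η → (κ x = κ z ↔ x ∈ κ z) := fun {x z} hx =>
    ⟨fun h => h ▸ mem_connectedComponentIn hx, fun h => (connectedComponentIn_eq h).symm⟩
  have hfiber : ∀ K : Set ℂ, Nonempty ({i // κ (a i) = K} ≃ {j // κ (b j) = K}) := by
    intro K
    by_cases hK : ∃ z ∈ levelSet B η, κ z = K
    · obtain ⟨z, hz, rfl⟩ := hK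
      obtain ⟨e⟩ := card_zeros_component_eq ha hb hclose (hB η hη hη1 z hz)
      exact ⟨(Equiv.subtypeEquivRight fun i => hκ (haΩ i)).trans
        (e.trans (Equiv.subtypeEquivRight fun j => hκ (hbΩ j)).symm)⟩
    · have h1 : IsEmpty {i // κ (a i) = K} := ⟨fun i => hK ⟨_, haΩ i, i.2⟩⟩
      have h2 : IsEmpty {j // κ (b j) = K} := ⟨fun j => hK ⟨_, hbΩ j, j.2⟩⟩
      exact ⟨Equiv.equivOfIsEmpty _ _⟩
  let e : I ≃ J := (Equiv.sigmaFiberEquiv fun i => κ (a i)).symm.trans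
    ((Equiv.sigmaCongrRight fun K => (hfiber K).some).trans
      (Equiv.sigmaFiberEquiv fun j => κ (b j)))
  refine ⟨e, fun i => pseudoHypDist_le_componentDiam (haΩ i) ?_⟩
  exact (hκ (hbΩ _)).1 ((hfiber (κ (a i))).some ⟨i, rfl⟩).2

/-! ### Comparison of the level sets -/

/-- Moving the zero of a Blaschke factor by at most `δ₀` changes the modulus at most by the
exponent `γ`, at points where the modulus is at least `δ`. -/
theorem pseudoHypDist_rpow_le {δ₀ δ γ : ℝ} (hδ₀_lt : δ₀ < 1 / Real.exp 1)
    (hδ : δ = δ₀ ^ (1 - 1 / Real.sqrt (-Real.log δ₀)))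
    (hγ : γ = 1 + 2 / Real.sqrt (-Real.log δ₀)) {z a b : ℂ} (hz : ‖z‖ < 1) (ha : ‖a‖ < 1)
    (hb : ‖b‖ < 1) (hab : pseudoHypDist a b ≤ δ₀) (hzb : δ ≤ pseudoHypDist z b) :
    pseudoHypDist z b ^ γ ≤ pseudoHypDist z a := by
  rcases ((pseudoHypDist_nonneg a b).trans hab).eq_or_lt with h0 | hpos
  · rw [← h0] at hab
    -- here `γ = 1`, as `log 0 = 0`
    rw [← h0, Real.log_zero, neg_zero, Real.sqrt_zero, div_zero, add_zero] at hγ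
    rw [hγ, Real.rpow_one,
      eq_of_pseudoHypDist_eq_zero ha hb (le_antisymm hab (pseudoHypDist_nonneg a b))]
  · set s := Real.sqrt (-Real.log δ₀) with hs
    have hL : 1 < -Real.log δ₀ := by
      have := Real.log_lt_log hpos hδ₀_lt
      rw [one_div, Real.log_inv, Real.log_exp] at this
      linarith
    have hs1 : 1 ≤ s := Real.one_le_sqrt.2 hL.le
    have hs2 : s ^ 2 = -Real.log δ₀ := Real.sq_sqrt (by linarith)
    have hd : Real.exp (-s ^ 2) = δ₀ := by rw [hs2, neg_neg, Real.exp_log hpos]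
    have hD : Real.exp (-s ^ 2 + s) = δ := by
      rw [hδ, ← hd, ← Real.exp_mul]
      congr 1
      field_simp
      ring
    have h1 := rpow_mul_one_sub_le_sub hs1 (hD.trans_le hzb) (pseudoHypDist_lt_one hz hb).le
    rw [hd, ← hγ] at h1
    have h2 := pseudoHypDist_sub_le hz ha hb hab
    have h3 : 0 < 1 - pseudoHypDist z b * δ₀ := by
      have h4 : δ₀ < 1 := by
        rw [← hd, Real.exp_lt_one_iff]; nlinarith
      nlinarith [pseudoHypDist_lt_one hz hb, pseudoHypDist_nonneg z b]
    exact le_of_mul_le_mul_right (h1.trans h2) h3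

/-- The estimate for single factors, multiplied over all pairs of zeros. -/
theorem norm_rpow_le_norm {B Bt : ℂ → ℂ} {I J : Type} {a : I → ℂ} {b : J → ℂ}
    (ha : IsBlaschkeZeroFamily B a) (hb : IsBlaschkeZeroFamily Bt b) {δ₀ δ γ : ℝ}
    (hδ₀_lt : δ₀ < 1 / Real.exp 1)
    (hδ : δ = δ₀ ^ (1 - 1 / Real.sqrt (-Real.log δ₀)))
    (hγ : γ = 1 + 2 / Real.sqrt (-Real.log δ₀)) (e : I ≃ J)
    (he : ∀ i, pseudoHypDist (a i) (b (e i)) ≤ δ₀) {z : ℂ} (hz : z ∈ unitDiskC)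
    (hzδ : δ ≤ ‖Bt z‖) : ‖Bt z‖ ^ γ ≤ ‖B z‖ := by
  have hγ0 : 0 ≤ γ := by rw [hγ]; positivity
  have hb' := e.hasProd_iff.2 (hb.hasProd_norm hz)
  have ha' := ha.hasProd_norm hz
  refine le_of_tendsto_of_tendsto'
    (((Real.continuous_rpow_const hγ0).tendsto _).comp hb') ha' fun S => ?_
  simp only [Function.comp_apply]
  rw [← Real.finsetProd_rpow _ _ fun i _ => pseudoHypDist_nonneg _ _]
  refine Finset.prod_le_prod (fun i _ => Real.rpow_nonneg (pseudoHypDist_nonneg _ _) _)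
    fun i _ => ?_
  exact pseudoHypDist_rpow_le hδ₀_lt hδ hγ (mem_unitDiskC.1 hz) (ha.1 i) (hb.1 _) (he i)
    (hzδ.trans (hb.norm_le_pseudoHypDist hz _))

theorem pos_of_nonempty_sublevel {u : ℂ → ℂ} {t : ℝ} {z : ℂ} (hz : z ∈ sublevel u t) : 0 < t := by
  by_contra! h
  exact (isEmpty_sublevel u h).false ⟨z, hz⟩

/-- Points where `|Bt| < δ` are below the level `T`; at the others the power estimate applies. -/
theorem sublevel_subset_sublevel_add {B Bt : ℂ → ℂ} {δ γ T Δ : ℝ} (hγ : 1 ≤ γ)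
    (hT : δ ≤ thetaParam T) (hTΔ : T ≤ Δ) (hΔ : 2 * Real.log γ ≤ Δ)
    (h : ∀ z ∈ unitDiskC, δ ≤ ‖Bt z‖ → ‖Bt z‖ ^ γ ≤ ‖B z‖) (t : ℝ) :
    sublevel B t ⊆ sublevel Bt (t + Δ) := by
  intro z hz
  have ht := pos_of_nonempty_sublevel hz
  refine ⟨hz.1, ?_⟩
  rcases lt_or_ge ‖Bt z‖ δ with hlt | hge
  · exact hlt.trans_le (hT.trans (thetaParam_mono (by linarith)))
  · exact lt_thetaParam_add hγ (norm_nonneg _) ((h z hz.1 hge).trans_lt hz.2) hΔ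

theorem thetaParam_log {x : ℝ} (hx : -1 < x) (hx1 : x < 1) :
    thetaParam (Real.log ((1 + x) / (1 - x))) = x := by
  have h1 : 0 < 1 - x := by linarith
  have h2 : 0 < 1 + x := by linarith
  unfold thetaParam
  rw [Real.exp_log (by positivity)]
  field_simp
  ring

/-! ### Interleaving by inclusions -/

/-- The morphism of persistence modules induced by inclusions `Σ_{u,t} ⊆ Σ_{v,t+Δ}`. -/
noncomputable def sublevelShift {u v : ℂ → ℂ} {Δ : ℝ} (h : ∀ t, sublevel u t ⊆ sublevel v (t + Δ)) :
    sublevelFunctor u ⟶ shiftReal Δ ⋙ sublevelFunctor v where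
  app t := TopCat.ofHom ⟨Set.inclusion (h t), continuous_inclusion (h t)⟩
  naturality _ _ _ := rfl

theorem interleaved_of_sublevel_subset {𝔽 : Type u} [Field 𝔽] (H : TopCat.{0} ⥤ ModuleCat.{u} 𝔽)
    {V W : PersistenceModule 𝔽} {u v : ℂ → ℂ} (hV : V.toFunctor = sublevelFunctor u ⋙ H)
    (hW : W.toFunctor = sublevelFunctor v ⋙ H) {Δ : ℝ} (hΔ : 0 < Δ)
    (huv : ∀ t, sublevel u t ⊆ sublevel v (t + Δ)) (hvu : ∀ t, sublevel v t ⊆ sublevel u (t + Δ)) :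
    V.Interleaved W Δ := by
  obtain ⟨V, hV0⟩ := V
  obtain ⟨W, hW0⟩ := W
  simp only at hV hW
  subst hV hW
  refine ⟨hΔ, Functor.whiskerRight (sublevelShift huv) H,
    Functor.whiskerRight (sublevelShift hvu) H, fun t => ?_, fun t => ?_⟩
  · exact (H.map_comp _ _).symm
  · exact (H.map_comp _ _).symm

theorem mainTheorem3 (𝔽 : Type u) [Field 𝔽] (B Bt : ℂ → ℂ) (η : ℝ)
    (hB : IsBlaschkeProduct B) (hBt : IsBlaschkeProduct Bt)
    (hBη : HasStrongPropertyB B η) (hBtη : HasStrongPropertyB Bt η)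
    (δ₀ δ γ T₀ : ℝ)
    (hδ₀ : δ₀ = min (componentDiam B η) (componentDiam Bt η))
    (hδ₀_lt : δ₀ < 1 / Real.exp 1)
    (hδ : δ = δ₀ ^ (1 - 1 / Real.sqrt (-Real.log δ₀)))
    (hδ_lt : δ < 1 - 2 * η)
    (hγ : γ = 1 + 2 / Real.sqrt (-Real.log δ₀))
    (hT₀ : T₀ = Real.log ((1 + (δ + 2 * η)) / (1 - (δ + 2 * η))))
    (hnorm : diskSupNorm (fun z => Bt z - B z) < ENNReal.ofReal η) :
    (levelPersistence 𝔽 B).intDist (levelPersistence 𝔽 Bt) ≤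
        ENNReal.ofReal (max T₀ (2 * Real.log γ)) ∧
      (levelPersistenceDeg 𝔽 0 B).intDist (levelPersistenceDeg 𝔽 0 Bt) ≤
        ENNReal.ofReal (max T₀ (2 * Real.log γ)) := by
  obtain ⟨hη, hη1, hPB, -⟩ := hBη
  obtain ⟨-, -, hPBt, -⟩ := hBtη
  have hclose : ∀ z ∈ unitDiskC, ‖Bt z - B z‖ < η := by
    intro z hz
    have h1 : ENNReal.ofReal ‖Bt z - B z‖ ≤ diskSupNorm (fun z => Bt z - B z) :=
      le_iSup₂ (f := fun z (_ : z ∈ unitDiskC) => ENNReal.ofReal ‖Bt z - B z‖) z hz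
    exact (ENNReal.ofReal_lt_ofReal_iff hη).1 (h1.trans_lt hnorm)
  obtain ⟨I, a, ha⟩ := hB.exists_zeroFamily
  obtain ⟨J, b, hb⟩ := hBt.exists_zeroFamily
  -- the pairing is made in the components of the level set with the smaller diameter
  obtain ⟨e, he⟩ : ∃ e : I ≃ J, ∀ i, pseudoHypDist (a i) (b (e i)) ≤ δ₀ := by
    rcases min_choice (componentDiam B η) (componentDiam Bt η) with h | h
    · rw [hδ₀, h]
      exact exists_equiv_zeros ha hb hη hη1 hPB hclose
    · rw [hδ₀, h]
      obtain ⟨e, he⟩ := exists_equiv_zeros hb ha hη hη1 hPBt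
        fun z hz => by rw [norm_sub_rev]; exact hclose z hz
      refine ⟨e.symm, fun i => ?_⟩
      have := he (e.symm i)
      rwa [e.apply_symm_apply, pseudoHypDist_comm] at this
  have he' : ∀ j, pseudoHypDist (b j) (a (e.symm j)) ≤ δ₀ := fun j => by
    have := he (e.symm j)
    rwa [e.apply_symm_apply, pseudoHypDist_comm] at this
  have hδ₀0 : 0 ≤ δ₀ := by
    have h0 : ∀ u, 0 ≤ componentDiam u η := fun u => by
      refine Real.sSup_nonneg ?_
      rintro r ⟨z, -, w, -, rfl⟩
      exact pseudoHypDist_nonneg z w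
    rw [hδ₀]
    exact le_min (h0 B) (h0 Bt)
  have hδ0 : 0 ≤ δ := hδ ▸ Real.rpow_nonneg hδ₀0 _
  have hγ1 : 1 ≤ γ := by
    rw [hγ]
    exact le_add_of_nonneg_right (by positivity)
  have hθ : thetaParam T₀ = δ + 2 * η := by
    rw [hT₀]
    exact thetaParam_log (by linarith) (by linarith)
  have hδT : δ ≤ thetaParam T₀ := by linarith
  have hT₀pos : 0 < T₀ := by
    by_contra! h
    linarith [thetaParam_nonpos h]
  have hΔ : 0 < max T₀ (2 * Real.log γ) := lt_max_of_lt_left hT₀pos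
  have h1 := sublevel_subset_sublevel_add hγ1 hδT (le_max_left _ _) (le_max_right _ _)
    fun z hz => norm_rpow_le_norm ha hb hδ₀_lt hδ hγ e he hz
  have h2 := sublevel_subset_sublevel_add hγ1 hδT (le_max_left _ _) (le_max_right _ _)
    fun z hz => norm_rpow_le_norm hb ha hδ₀_lt hδ hγ e.symm he' hz
  exact ⟨iInf₂_le _ (interleaved_of_sublevel_subset (totalHomologyF 𝔽) rfl rfl hΔ h1 h2),
    iInf₂_le _ (interleaved_of_sublevel_subset (homologyF 𝔽 0) rfl rfl hΔ h1 h2)⟩
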